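/- **Proposition 1.** Let $(M,g_{ab})$ be a smooth, time-oriented 4-dimensional spacetime with metric of signature $(-,+,+,+)$ and Levi-Civita connection $\nabla$, and let $R\subseteq M$ be an open region that admits a timelike Killing vector field, i.e. a smooth vector field $\xi^a$ on $R$ with $\nabla_a\xi_b+\nabla_b\xi_a=0$ and $g_{ab}\xi^a\xi^b<0$ everywhere on $R$. Then $R$ does not contain any complete (i.e. entire) marginally trapped surface $S$ belonging to the foliation of a dynamical horizon segment (DHS) of $M$. In particular, $R$ does not contain a DHS. Here a closed (compact, without boundary) spacelike 2-dimensional submanifold $S$ with future-directed null normals $k^a,\underline{k}^a$, normalized by $k^a\underline{k}_a=-1$, is a *marginally trapped surface* (MTS) if $\Theta_{(k)}=0$, where $\Theta_{(k)}=q^{ab}\nabla_a k_b$ and $\Theta_{(\underline k)}=q^{ab}\nabla_a\underline{k}_b$ are the expansions and $q_{ab}$ is the metric induced on $S$. A *dynamical horizon segment* is a connected 3-dimensional submanifold $H$ of $M$, with or without boundary, which is nowhere null and such that 1. $H$ is foliated by MTSs, each diffeomorphic to $S^2$, with $\Theta_{(k)}=0$; 2. $\Theta_{(\underline k)}$ vanishes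 nowhere on the MTSs; 3. $\mathcal{E}=\sigma^{(k)}_{ab}\sigma_{(k)}^{ab}+R_{ab}k^ak^b$ does not vanish identically on any of the MTSs, where $R_{ab}$ is the Ricci tensor of $g_{ab}$ and $\sigma^{(k)}_{ab}=\bigl(q_a{}^cq_b{}^d-\tfrac12 q_{ab}q^{cd}\bigr)\nabla_{(c}k_{d)}$ is the shear of $k^a$. -/

import Mathlib

open scoped Manifold ContDiff Matrix

noncomputable section

namespace DHS

/-- The model space `ℝ⁴` of a spacetime. -/
abbrev E4 : Type := EuclideanSpace ℝ (Fin 4)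

/-- The standard two-sphere, as a smooth manifold. -/
abbrev TwoSphere : Type := Metric.sphere (0 : EuclideanSpace ℝ (Fin (2 + 1))) 1

/-- A spacetime structure on a smooth 4-manifold `M`: a smooth metric of signature `(-,+,+,+)`
together with a time orientation, given by a smooth timelike vector field declared to be
future directed. -/
structure Spacetime (M : Type*) [TopologicalSpace M] [ChartedSpace E4 M]
    [IsManifold (𝓡 4) ∞ M] where
  /-- The metric `g_{ab}`. -/
  metric (x : M) : TangentSpace (𝓡 4) x →L[ℝ] TangentSpace (𝓡 4) x →L[ℝ] ℝ
  symm (x : M) (v w : TangentSpace (𝓡 4) x) : metric x v w = metric x w v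
  contMDiff_metric : ContMDiff (𝓡 4) ((𝓡 4).prod 𝓘(ℝ, E4 →L[ℝ] E4 →L[ℝ] ℝ)) ∞
    (fun x ↦ Bundle.TotalSpace.mk' (E4 →L[ℝ] E4 →L[ℝ] ℝ)
      (E := fun x : M ↦ TangentSpace (𝓡 4) x →L[ℝ] TangentSpace (𝓡 4) x →L[ℝ] ℝ) x (metric x))
  signature (x : M) : ∃ b : Module.Basis (Fin 4) ℝ (TangentSpace (𝓡 4) x), ∀ i j,
    metric x (b i) (b j) = if i = j then (if i = 0 then -1 else 1) else 0
  /-- The vector field that fixes the time orientation. -/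
  timeField (x : M) : TangentSpace (𝓡 4) x
  contMDiff_timeField : ContMDiff (𝓡 4) (𝓡 4).tangent ∞
    (fun x ↦ (⟨x, timeField x⟩ : TangentBundle (𝓡 4) M))
  timelike_timeField (x : M) : metric x (timeField x) (timeField x) < 0

section LeviCivita

variable {M : Type*} [TopologicalSpace M] [ChartedSpace E4 M] [IsManifold (𝓡 4) ∞ M]

/-- A nonzero causal vector is future directed if it lies in the same cone as the time
orientation. -/
def Spacetime.IsFutureDirected (g : Spacetime M) {x : M} (v : TangentSpace (𝓡 4) x) : Prop :=
  v ≠ 0 ∧ g.metric x v v ≤ 0 ∧ g.metric x v (g.timeField x) < 0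

/-- The coordinate vector field `∂_a` of the preferred chart at `x`, at a point `p` of the chart
domain. At `p = x` it is the standard basis vector of `TangentSpace (𝓡 4) x = ℝ⁴`. -/
def coordVec (x : M) (a : Fin 4) (p : M) : TangentSpace (𝓡 4) p :=
  (trivializationAt E4 (TangentSpace (𝓡 4) : M → Type _) x).symmL ℝ p
    (EuclideanSpace.single a (1 : ℝ))

/-- The matrix `g_{ab}(y)` of the metric in the preferred chart at `x`, as a function of the
coordinates `y`. -/
def Spacetime.coeff (g : Spacetime M) (x : M) (y : E4) : Matrix (Fin 4) (Fin 4) ℝ :=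
  Matrix.of fun a b ↦
    g.metric ((extChartAt (𝓡 4) x).symm y)
      (coordVec x a ((extChartAt (𝓡 4) x).symm y))
      (coordVec x b ((extChartAt (𝓡 4) x).symm y))

/-- The partial derivative `∂_a f` at `y` of a function of four coordinates. -/
def partialDeriv (a : Fin 4) (f : E4 → ℝ) (y : E4) : ℝ :=
  fderiv ℝ f y (EuclideanSpace.single a (1 : ℝ))

/-- The Christoffel symbol `Γ^c_{ab}(y)` of the metric in the preferred chart at `x`. -/
def Spacetime.christoffel (g : Spacetime M) (x : M) (c a b : Fin 4) (y : E4) : ℝ :=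
  (1 / 2) * ∑ d, (g.coeff x y)⁻¹ c d *
    (partialDeriv a (fun z ↦ g.coeff x z b d) y + partialDeriv b (fun z ↦ g.coeff x z a d) y
      - partialDeriv d (fun z ↦ g.coeff x z a b) y)

/-- The Ricci component `R_{ab}(y)` in the preferred chart at `x`:
`R_{ab} = ∂_c Γ^c_{ab} - ∂_b Γ^c_{ac} + Γ^c_{cd} Γ^d_{ab} - Γ^c_{bd} Γ^d_{ac}`. -/
def Spacetime.ricciCoeff (g : Spacetime M) (x : M) (a b : Fin 4) (y : E4) : ℝ :=
  ∑ c, (partialDeriv c (g.christoffel x c a b) y - partialDeriv b (g.christoffel x c a c) y)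
    + ∑ c, ∑ d, (g.christoffel x c c d y * g.christoffel x d a b y
      - g.christoffel x c b d y * g.christoffel x d a c y)

/-- The component `v^a` of a tangent vector at `x` in the preferred chart at `x`. -/
def comp {x : M} (v : TangentSpace (𝓡 4) x) (a : Fin 4) : ℝ := (show E4 from v) a

/-- The Ricci tensor `R_{ab} u^a v^b` at `x`. -/
def Spacetime.ricci (g : Spacetime M) (x : M) (u v : TangentSpace (𝓡 4) x) : ℝ :=
  ∑ a, ∑ b, g.ricciCoeff x a b (extChartAt (𝓡 4) x x) * comp u a * comp v b

variable {E : Type*} [NormedAddCommGroup E] [NormedSpace ℝ E]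
  {G : Type*} [TopologicalSpace G] {N : Type*} [TopologicalSpace N] [ChartedSpace G N]

/-- The Levi-Civita covariant derivative `∇_u V` at `y` of a vector field `V` along a map
`F : N → M`, in the direction `u ∈ T_y N`: in the preferred chart at `F y`,
`(∇_u V)^c = u(V^c) + Γ^c_{ab} (dF u)^a V^b`. With `F = id` this is the covariant derivative of a
vector field on `M`. -/
def Spacetime.covDeriv (g : Spacetime M) (J : ModelWithCorners ℝ E G) (F : N → M)
    (V : Π y : N, TangentSpace (𝓡 4) (F y)) (y : N) (u : TangentSpace J y) :
    TangentSpace (𝓡 4) (F y) :=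
  show E4 from
    (show E4 from mfderiv J 𝓘(ℝ, E4)
      (fun z ↦ (trivializationAt E4 (TangentSpace (𝓡 4) : M → Type _) (F y)
        (⟨F z, V z⟩ : TangentBundle (𝓡 4) M)).2) y u)
    + WithLp.toLp 2 fun c ↦ ∑ a, ∑ b,
        g.christoffel (F y) c a b (extChartAt (𝓡 4) (F y) (F y))
          * comp (mfderiv J (𝓡 4) F y u) a * comp (V y) b

/-- `ξ` is a (smooth) Killing vector field on the open set `R`:
`∇_a ξ_b + ∇_b ξ_a = 0` on `R`. Values of `ξ` outside `R` play no role. -/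
structure Spacetime.IsKillingOn (g : Spacetime M) (ξ : Π x : M, TangentSpace (𝓡 4) x)
    (R : Set M) : Prop where
  contMDiffOn : ContMDiffOn (𝓡 4) (𝓡 4).tangent ∞
    (fun x ↦ (⟨x, ξ x⟩ : TangentBundle (𝓡 4) M)) R
  killing : ∀ x ∈ R, ∀ u v : TangentSpace (𝓡 4) x,
    g.metric x (g.covDeriv (𝓡 4) id ξ x u) v + g.metric x (g.covDeriv (𝓡 4) id ξ x v) u = 0

end LeviCivita

section Surfaces

variable {M : Type*} [TopologicalSpace M] [ChartedSpace E4 M] [IsManifold (𝓡 4) ∞ M]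
  {N : Type*} [TopologicalSpace N] [ChartedSpace (EuclideanSpace ℝ (Fin 2)) N]

/-- The `i`-th vector of the standard basis of `T_y N`. -/
def surfVec (y : N) (i : Fin 2) : TangentSpace (𝓡 2) y :=
  (EuclideanSpace.single i (1 : ℝ) : EuclideanSpace ℝ (Fin 2))

/-- The matrix `q_{ij}` of the intrinsic metric of the surface `σ : N → M`. -/
def Spacetime.surfMetric (g : Spacetime M) (σ : N → M) (y : N) : Matrix (Fin 2) (Fin 2) ℝ :=
  Matrix.of fun i j ↦ g.metric (σ y) (mfderiv (𝓡 2) (𝓡 4) σ y (surfVec y i))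
    (mfderiv (𝓡 2) (𝓡 4) σ y (surfVec y j))

/-- The projection to the surface `σ : N → M` of `∇_a k_b`, for a vector field `k` along `σ`:
the matrix `e_i^a e_j^b ∇_a k_b`. -/
def Spacetime.surfDeriv (g : Spacetime M) (σ : N → M) (k : Π y : N, TangentSpace (𝓡 4) (σ y))
    (y : N) : Matrix (Fin 2) (Fin 2) ℝ :=
  Matrix.of fun i j ↦ g.metric (σ y) (g.covDeriv (𝓡 2) σ k y (surfVec y i))
    (mfderiv (𝓡 2) (𝓡 4) σ y (surfVec y j))

/-- The expansion `Θ_{(k)} = q^{ab} ∇_a k_b`. -/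
def Spacetime.expansion (g : Spacetime M) (σ : N → M) (k : Π y : N, TangentSpace (𝓡 4) (σ y))
    (y : N) : ℝ :=
  ∑ i, ∑ j, (g.surfMetric σ y)⁻¹ i j * g.surfDeriv σ k y i j

/-- The shear `σ_{ab} = (q_a^c q_b^d - ½ q_{ab} q^{cd}) ∇_{(c} k_{d)}`. -/
def Spacetime.shear (g : Spacetime M) (σ : N → M) (k : Π y : N, TangentSpace (𝓡 4) (σ y))
    (y : N) : Matrix (Fin 2) (Fin 2) ℝ :=
  (1 / 2 : ℝ) • (g.surfDeriv σ k y + (g.surfDeriv σ k y)ᵀ)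
    - (g.expansion σ k y / 2) • g.surfMetric σ y

/-- The square `σ_{ab} σ^{ab}` of the shear. -/
def Spacetime.shearSq (g : Spacetime M) (σ : N → M) (k : Π y : N, TangentSpace (𝓡 4) (σ y))
    (y : N) : ℝ :=
  ∑ i, ∑ j, ∑ l, ∑ m, (g.surfMetric σ y)⁻¹ i l * (g.surfMetric σ y)⁻¹ j m
    * g.shear σ k y i j * g.shear σ k y l m

/-- The quantity `𝓔 = σ_{ab} σ^{ab} + R_{ab} k^a k^b`. -/
def Spacetime.energyFlux (g : Spacetime M) (σ : N → M) (k : Π y : N, TangentSpace (𝓡 4) (σ y))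
    (y : N) : ℝ :=
  g.shearSq σ k y + g.ricci (σ y) (k y) (k y)

/-- `k` is a smooth field of future directed null normals of the surface `σ : N → M`. -/
structure Spacetime.IsFutureNullNormal (g : Spacetime M) (σ : N → M)
    (k : Π y : N, TangentSpace (𝓡 4) (σ y)) : Prop where
  contMDiff : ContMDiff (𝓡 2) (𝓡 4).tangent ∞
    (fun y ↦ (⟨σ y, k y⟩ : TangentBundle (𝓡 4) M))
  null : ∀ y, g.metric (σ y) (k y) (k y) = 0
  normal : ∀ y, ∀ u : TangentSpace (𝓡 2) y,
    g.metric (σ y) (k y) (mfderiv (𝓡 2) (𝓡 4) σ y u) = 0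
  future : ∀ y, g.IsFutureDirected (k y)

/-- The embedded closed surface `σ : N → M` is a marginally trapped surface: it is spacelike,
`k` and `k'` are its two future directed null normals, normalized by `k^a k'_a = -1`, and the
expansion of `k` vanishes. -/
structure Spacetime.IsMTS (g : Spacetime M) [IsManifold (𝓡 2) ∞ N] [CompactSpace N] (σ : N → M)
    (k k' : Π y : N, TangentSpace (𝓡 4) (σ y)) : Prop where
  embedding : Manifold.IsSmoothEmbedding (𝓡 2) (𝓡 4) ∞ σ
  spacelike : ∀ y, ∀ u : TangentSpace (𝓡 2) y, u ≠ 0 →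
    0 < g.metric (σ y) (mfderiv (𝓡 2) (𝓡 4) σ y u) (mfderiv (𝓡 2) (𝓡 4) σ y u)
  nullNormal : g.IsFutureNullNormal σ k
  nullNormal' : g.IsFutureNullNormal σ k'
  normalized : ∀ y, g.metric (σ y) (k y) (k' y) = -1
  expansion_eq_zero : ∀ y, g.expansion σ k y = 0

end Surfaces

section Horizons

variable {M : Type*} [TopologicalSpace M] [ChartedSpace E4 M] [IsManifold (𝓡 4) ∞ M]
  {H : Type*} [TopologicalSpace H] [ChartedSpace (EuclideanHalfSpace 3) H]

/-- The 3-manifold `H`, possibly with boundary, is smoothly foliated by the members of `leaves`,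
as a codimension one foliation: `leaves` is a partition of `H`, and around every point there is a
smooth chart of `H` in which the leaves are unions of plaques `x⁰ = const`. In the charts of a
manifold with boundary the boundary is `x⁰ = 0`. -/
def IsFoliation (H : Type*) [TopologicalSpace H] [ChartedSpace (EuclideanHalfSpace 3) H]
    (leaves : Set (Set H)) : Prop :=
  Setoid.IsPartition leaves ∧
    ∀ p : H, ∃ e ∈ IsManifold.maximalAtlas (𝓡∂ 3) ∞ H, p ∈ e.source ∧
      ∀ L ∈ leaves, ∃ C : Set ℝ, ∀ q ∈ e.source, q ∈ L ↔ (e q).1 0 ∈ C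

/-- `H`, embedded in `M` by `j`, is a dynamical horizon segment whose foliation by marginally
trapped surfaces has the given leaves. The model `𝓡∂ 3` allows `H` to have a boundary but does
not require one. -/
structure Spacetime.IsDHSWith (g : Spacetime M) [IsManifold (𝓡∂ 3) ∞ H] (j : H → M)
    (leaves : Set (Set H)) : Prop where
  connected : ConnectedSpace H
  embedding : Manifold.IsSmoothEmbedding (𝓡∂ 3) (𝓡 4) ∞ j
  /-- The metric induced on `H` is nowhere degenerate. -/
  nowhere_null : ∀ p : H, ∀ u : TangentSpace (𝓡∂ 3) p,
    (∀ v : TangentSpace (𝓡∂ 3) p,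
      g.metric (j p) (mfderiv (𝓡∂ 3) (𝓡 4) j p u) (mfderiv (𝓡∂ 3) (𝓡 4) j p v) = 0) → u = 0
  foliation : IsFoliation H leaves
  /-- Each leaf is a marginally trapped 2-sphere, the other expansion vanishes nowhere on it, and
  `𝓔` does not vanish identically on it. -/
  leaf : ∀ L ∈ leaves, ∃ (σ : TwoSphere → M) (k k' : Π y, TangentSpace (𝓡 4) (σ y)),
    Set.range σ = j '' L ∧ g.IsMTS σ k k' ∧
      (∀ y, g.expansion σ k' y ≠ 0) ∧ ∃ y, g.energyFlux σ k y ≠ 0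

/-- `H`, embedded in `M` by `j`, is a dynamical horizon segment. -/
def Spacetime.IsDHS (g : Spacetime M) [IsManifold (𝓡∂ 3) ∞ H] (j : H → M) : Prop :=
  ∃ leaves : Set (Set H), g.IsDHSWith j leaves

end Horizons

end DHS

end

/-! Let `S` be a marginally trapped sphere in `R`, with null normals `k`, `k'`. Split the Killing
field along `S` into a tangential part and the normal part `-(ξ·k') k - (ξ·k) k'`. Killing's
equation makes the trace of `∇ξ` over `S` vanish, so the divergence of the tangential part is
`(ξ·k') Θ_k + (ξ·k) Θ_k'`, which equals `(ξ·k) Θ_k'` because `Θ_k = 0`. A timelike vector is never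
orthogonal to a nonzero null vector, so `ξ·k` has no zero. The divergence of a tangent field on a
closed surface must vanish somewhere, hence so must `Θ_k'`, contrary to the second condition on a
DHS.

Integration over `S` is carried out in punctured Euclidean 3-space. The immersion `σ` is extended to
`F = σ ∘ radialProj`, constant along rays. The induced form then degenerates exactly in the radial
direction, and the tangential part of `ξ`, weighted by area, becomes a field `tangentDensity`
tangent to the spheres about the origin, whose Euclidean divergence is the area density times the
surface divergence. `exists_divergence_eq_zero` supplies a zero of this divergence by means of a
radial cutoff.

The pointwise formula is `sum_inner_fderiv_tangentDensity`. It rests on metric compatibility and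
torsion-freeness along maps (`hasFDerivAt_metric`, `covDeriv_mfderiv_comm`) and on the index
computation `divergence_dualDensity_algebra`. `gram_det_mul_expansion` turns its right-hand side
into expansions, and `metric_ne_zero_of_timelike_of_null` gives `ξ·k ≠ 0`. -/

noncomputable section

namespace DHS

/-! ### The metric and its Christoffel symbols in a chart -/

section Coordinates

variable {M : Type*} [TopologicalSpace M] [ChartedSpace E4 M] [IsManifold (𝓡 4) ∞ M]

/-- The components of a tangent vector at `q` in the preferred chart at `x`. -/
def chartComp (x : M) {q : M} (v : TangentSpace (𝓡 4) q) : E4 :=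
  (trivializationAt E4 (TangentSpace (𝓡 4) : M → Type _) x (⟨q, v⟩ : TangentBundle (𝓡 4) M)).2

theorem chartComp_eq_continuousLinearMapAt (x : M) {q : M} (hq : q ∈ (chartAt E4 x).source)
    (v : TangentSpace (𝓡 4) q) :
    chartComp x v = (trivializationAt E4 (TangentSpace (𝓡 4) : M → Type _) x).continuousLinearMapAt
      ℝ q v := by
  rw [Bundle.Trivialization.continuousLinearMapAt_apply,
    Bundle.Trivialization.coe_linearMapAt_of_mem _ (by simpa using hq)]
  rfl

theorem chartComp_eq_mfderiv (x : M) {q : M} (hq : q ∈ (chartAt E4 x).source)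
    (v : TangentSpace (𝓡 4) q) :
    chartComp x v = mfderiv (𝓡 4) 𝓘(ℝ, E4) (extChartAt (𝓡 4) x) q v := by
  rw [chartComp_eq_continuousLinearMapAt x hq,
    TangentBundle.continuousLinearMapAt_trivializationAt hq]
  rfl

/-- The tangent coordinate change from a chart to itself is the identity. Covariant derivatives are
therefore computed in the chart centred at their own base point, where a vector coincides with its
components. -/
theorem chartComp_self (x : M) (v : TangentSpace (𝓡 4) x) : chartComp x v = v := by
  rw [chartComp, TangentBundle.trivializationAt_apply]
  exact tangentCoordChange_self (I := 𝓡 4) (x := x) (z := x) (v := v) (mem_extChartAt_source x)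

theorem eq_sum_coordVec (x : M) {q : M} (hq : q ∈ (chartAt E4 x).source)
    (v : TangentSpace (𝓡 4) q) : v = ∑ a, chartComp x v a • coordVec x a q := by
  have h1 : (trivializationAt E4 (TangentSpace (𝓡 4) : M → Type _) x).symmL ℝ q
      (chartComp x v) = v := by
    rw [chartComp_eq_continuousLinearMapAt x hq]
    exact Bundle.Trivialization.symmL_continuousLinearMapAt _ (by simpa using hq) v
  have h2 : chartComp x v = ∑ a, chartComp x v a • EuclideanSpace.single a (1 : ℝ) := by
    ext i
    simp [Finset.sum_apply, Pi.single_apply]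
  conv_lhs => rw [← h1, h2, map_sum]
  simp only [map_smul]
  rfl

theorem Spacetime.coeff_extChartAt (g : Spacetime M) (x : M) {q : M}
    (hq : q ∈ (chartAt E4 x).source) (a b : Fin 4) :
    g.coeff x (extChartAt (𝓡 4) x q) a b = g.metric q (coordVec x a q) (coordVec x b q) := by
  have hs : (extChartAt (𝓡 4) x).symm (extChartAt (𝓡 4) x q) = q :=
    (extChartAt (𝓡 4) x).left_inv (by simpa using hq)
  rw [Spacetime.coeff, Matrix.of_apply, hs]

theorem Spacetime.metric_eq_sum_coeff (g : Spacetime M) (x : M) {q : M}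
    (hq : q ∈ (chartAt E4 x).source) (v w : TangentSpace (𝓡 4) q) :
    g.metric q v w = ∑ a, ∑ b, g.coeff x (extChartAt (𝓡 4) x q) a b
      * chartComp x v a * chartComp x w b := by
  conv_lhs => rw [eq_sum_coordVec x hq v, eq_sum_coordVec x hq w]
  simp only [map_sum, sum_apply, map_smul, smul_apply, smul_eq_mul, g.coeff_extChartAt x hq]
  simp only [Finset.mul_sum]
  rw [Finset.sum_comm]
  refine Finset.sum_congr rfl fun a _ ↦ Finset.sum_congr rfl fun b _ ↦ ?_
  ring

theorem Spacetime.coeff_symm (g : Spacetime M) (x : M) (y : E4) (a b : Fin 4) :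
    g.coeff x y a b = g.coeff x y b a := g.symm _ _ _

theorem Spacetime.eq_zero_of_forall_metric_eq_zero (g : Spacetime M) {x : M}
    (w : TangentSpace (𝓡 4) x) (h : ∀ v, g.metric x v w = 0) : w = 0 := by
  obtain ⟨b, hb⟩ := g.signature x
  have hw := b.sum_repr w
  have : ∀ i, b.repr w i = 0 := fun i ↦ by
    have h1 := h (b i)
    rw [← hw] at h1
    simp only [map_sum, map_smul, hb, smul_eq_mul, mul_ite, mul_zero, Finset.sum_ite_eq,
      Finset.mem_univ, if_true] at h1
    split_ifs at h1 <;> simpa using h1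
  rw [← hw]
  simp [this]

theorem contMDiffAt_coordVec (x : M) (a : Fin 4) :
    ContMDiffAt (𝓡 4) (𝓡 4).tangent ∞
      (fun p ↦ (⟨p, coordVec x a p⟩ : TangentBundle (𝓡 4) M)) x := by
  have h := Bundle.Trivialization.contMDiffAt_symmL (𝕜 := ℝ) (n := ∞) (IB := 𝓡 4)
    (trivializationAt E4 (TangentSpace (𝓡 4) : M → Type _) x)
    (mem_baseSet_trivializationAt E4 _ x)
  refine h.clm_bundle_apply (F₁ := E4) (E₁ := Bundle.Trivial M E4)
    (v := fun _ ↦ EuclideanSpace.single a (1 : ℝ)) ?_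
  exact Bundle.contMDiffAt_section _ |>.2 contMDiffAt_const

theorem Spacetime.contDiffAt_coeff (g : Spacetime M) (x : M) (a b : Fin 4) :
    ContDiffAt ℝ ∞ (fun y ↦ g.coeff x y a b) (extChartAt (𝓡 4) x x) := by
  have h := (g.contMDiff_metric.contMDiffAt (x := x)).clm_bundle_apply₂ (F₃ := ℝ)
    (E₃ := Bundle.Trivial M ℝ) (b := id)
    (contMDiffAt_coordVec x a) (contMDiffAt_coordVec x b)
  have h' : ContMDiffAt (𝓡 4) 𝓘(ℝ, ℝ) ∞
      (fun p ↦ g.metric p (coordVec x a p) (coordVec x b p)) x :=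
    Bundle.contMDiffAt_section _ |>.1 h
  have hs := (contMDiffOn_extChartAt_symm (I := 𝓡 4) (n := ∞) x).contMDiffAt
    (extChartAt_target_mem_nhds (I := 𝓡 4) x)
  exact (h'.comp_of_eq hs (extChartAt_to_inv (I := 𝓡 4) x)).contDiffAt

/-- A kernel vector of the matrix would be a tangent vector orthogonal to everything. Hence the `⁻¹`
in `christoffel` is a genuine inverse at the chart centre, not the default value `0`. -/
theorem Spacetime.isUnit_det_coeff (g : Spacetime M) (x : M) :
    IsUnit (g.coeff x (extChartAt (𝓡 4) x x)).det := by
  rw [isUnit_iff_ne_zero]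
  intro h0
  obtain ⟨w, hw, hw0⟩ := Matrix.exists_mulVec_eq_zero_iff.2 h0
  obtain ⟨w', hw'⟩ : ∃ w' : TangentSpace (𝓡 4) x, (show E4 from w') = WithLp.toLp 2 w := ⟨_, rfl⟩
  have h : w' = 0 := by
    refine g.eq_zero_of_forall_metric_eq_zero (x := x) _ fun v ↦ ?_
    rw [g.metric_eq_sum_coeff x (mem_chart_source E4 x), chartComp_self x v, chartComp_self x w']
    refine Finset.sum_eq_zero fun a _ ↦ ?_
    have := congrFun hw0 a
    simp only [Matrix.mulVec, dotProduct, Pi.zero_apply] at this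
    calc _ = (show E4 from v) a * ∑ b, g.coeff x (extChartAt (𝓡 4) x x) a b * w b := by
          rw [Finset.mul_sum]
          refine Finset.sum_congr rfl fun b _ ↦ ?_
          rw [show (show E4 from w') b = w b by rw [hw']]
          ring
      _ = 0 := by rw [this, mul_zero]
  have h1 : WithLp.toLp 2 w = (0 : E4) := hw'.symm.trans h
  exact hw (by simpa using h1)

theorem Spacetime.sum_coeff_mul_christoffel (g : Spacetime M) (x : M) (d a b : Fin 4) :
    ∑ c, g.coeff x (extChartAt (𝓡 4) x x) d c * g.christoffel x c a b (extChartAt (𝓡 4) x x)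
      = (1 / 2) * (partialDeriv a (fun z ↦ g.coeff x z b d) (extChartAt (𝓡 4) x x)
        + partialDeriv b (fun z ↦ g.coeff x z a d) (extChartAt (𝓡 4) x x)
        - partialDeriv d (fun z ↦ g.coeff x z a b) (extChartAt (𝓡 4) x x)) := by
  set y := extChartAt (𝓡 4) x x
  set T : Fin 4 → ℝ := fun d ↦ partialDeriv a (fun z ↦ g.coeff x z b d) y
    + partialDeriv b (fun z ↦ g.coeff x z a d) y - partialDeriv d (fun z ↦ g.coeff x z a b) y
  have h : (g.coeff x y) *ᵥ ((1 / 2 : ℝ) • ((g.coeff x y)⁻¹ *ᵥ T)) = (1 / 2 : ℝ) • T := by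
    rw [Matrix.mulVec_smul, Matrix.mulVec_mulVec, Matrix.mul_nonsing_inv _ (g.isUnit_det_coeff x),
      Matrix.one_mulVec]
  exact congrFun h d

/-- This is `∇g = 0` in coordinates: with the upper index lowered, four of the six metric
derivatives cancel in the sum and the other two agree. -/
theorem Spacetime.partialDeriv_coeff (g : Spacetime M) (x : M) (c a b : Fin 4) :
    partialDeriv c (fun z ↦ g.coeff x z a b) (extChartAt (𝓡 4) x x)
      = ∑ d, g.coeff x (extChartAt (𝓡 4) x x) b d * g.christoffel x d c a (extChartAt (𝓡 4) x x)
      + ∑ d, g.coeff x (extChartAt (𝓡 4) x x) a d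
        * g.christoffel x d c b (extChartAt (𝓡 4) x x) := by
  rw [g.sum_coeff_mul_christoffel, g.sum_coeff_mul_christoffel]
  simp only [g.coeff_symm x _ b a]
  ring

theorem Spacetime.christoffel_symm (g : Spacetime M) (x : M) (c a b : Fin 4) (y : E4) :
    g.christoffel x c a b y = g.christoffel x c b a y := by
  simp only [Spacetime.christoffel, g.coeff_symm x _ a b]
  congr 1
  refine Finset.sum_congr rfl fun d _ ↦ ?_
  ring

end Coordinates

/-! ### Covariant derivatives along maps -/

section AlongMaps

variable {M : Type*} [TopologicalSpace M] [ChartedSpace E4 M]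
  {E : Type*} [NormedAddCommGroup E] [NormedSpace ℝ E]

theorem contDiffAt_extChartAt_comp {F : E → M} {p : E} (hF : ContMDiffAt 𝓘(ℝ, E) (𝓡 4) ∞ F p) :
    ContDiffAt ℝ ∞ (fun z ↦ extChartAt (𝓡 4) (F p) (F z)) p :=
  ((contMDiffAt_extChartAt (I := 𝓡 4) (n := ∞) (x := F p)).comp p hF).contDiffAt

variable [IsManifold (𝓡 4) ∞ M]

theorem chartComp_mfderiv {F : E → M} {x₀ : M} {x : E} (hF : MDifferentiableAt 𝓘(ℝ, E) (𝓡 4) F x)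
    (hx : F x ∈ (chartAt E4 x₀).source) (u : E) :
    chartComp x₀ (mfderiv 𝓘(ℝ, E) (𝓡 4) F x u)
      = fderiv ℝ (fun z ↦ extChartAt (𝓡 4) x₀ (F z)) x u := by
  rw [chartComp_eq_mfderiv x₀ hx, ← mfderiv_eq_fderiv]
  have h := mfderiv_comp x (I := 𝓘(ℝ, E)) (I' := 𝓡 4) (I'' := 𝓘(ℝ, E4))
    (mdifferentiableAt_extChartAt (I := 𝓡 4) hx) hF
  exact (congrArg (fun A : E →L[ℝ] E4 ↦ A u) h).symm

theorem mfderiv_apply_eq_fderiv {F : E → M} {x : E} (hF : MDifferentiableAt 𝓘(ℝ, E) (𝓡 4) F x)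
    (u : E) : mfderiv 𝓘(ℝ, E) (𝓡 4) F x u
      = fderiv ℝ (fun z ↦ extChartAt (𝓡 4) (F x) (F z)) x u := by
  rw [← chartComp_mfderiv hF (mem_chart_source E4 (F x)), chartComp_self]

theorem Spacetime.covDeriv_apply (g : Spacetime M) {F : E → M}
    (V : Π y : E, TangentSpace (𝓡 4) (F y)) {p : E}
    (hF : MDifferentiableAt 𝓘(ℝ, E) (𝓡 4) F p) (u : E) (c : Fin 4) :
    (show E4 from g.covDeriv 𝓘(ℝ, E) F V p u) c
      = fderiv ℝ (fun z ↦ chartComp (F p) (V z)) p u c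
        + ∑ a, ∑ b, g.christoffel (F p) c a b (extChartAt (𝓡 4) (F p) (F p))
          * fderiv ℝ (fun z ↦ extChartAt (𝓡 4) (F p) (F z)) p u a * chartComp (F p) (V p) b := by
  rw [← chartComp_mfderiv hF (mem_chart_source E4 (F p)), chartComp_self, chartComp_self,
    ← mfderiv_eq_fderiv]
  rfl

theorem differentiableAt_chartComp {F : E → M} {V : Π y : E, TangentSpace (𝓡 4) (F y)} {p : E}
    (hV : MDifferentiableAt 𝓘(ℝ, E) (𝓡 4).tangent
      (fun y ↦ (⟨F y, V y⟩ : TangentBundle (𝓡 4) M)) p) :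
    DifferentiableAt ℝ (fun z ↦ chartComp (F p) (V z)) p :=
  ((mdifferentiableAt_totalSpace _ _).1 hV).2.differentiableAt

theorem mdifferentiableAt_base {F : E → M} {V : Π y : E, TangentSpace (𝓡 4) (F y)} {p : E}
    (hV : MDifferentiableAt 𝓘(ℝ, E) (𝓡 4).tangent
      (fun y ↦ (⟨F y, V y⟩ : TangentBundle (𝓡 4) M)) p) :
    MDifferentiableAt 𝓘(ℝ, E) (𝓡 4) F p :=
  ((mdifferentiableAt_totalSpace _ _).1 hV).1

theorem fderiv_eq_sum_partialDeriv {f : E4 → ℝ} (y v : E4) :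
    fderiv ℝ f y v = ∑ a, v a * partialDeriv a f y := by
  have h : v = ∑ a, v a • EuclideanSpace.single a (1 : ℝ) := by
    ext i
    simp [Finset.sum_apply, Pi.single_apply]
  conv_lhs => rw [h, map_sum]
  simp [partialDeriv]

/-- The index bookkeeping of metric compatibility: `f` is the velocity of the base point, primes are
directional derivatives, and the derivative of `G` has already been replaced by Christoffel symbols.
-/
theorem sum_metric_compatibility {ι : Type*} [Fintype ι] (G : ι → ι → ℝ) (hG : ∀ a b, G a b = G b a)
    (Γ : ι → ι → ι → ℝ) (f V W V' W' : ι → ℝ) :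
    ∑ a, ∑ b, (G a b * V a * W' b + W b * (G a b * V' a + V a *
      ∑ c, f c * (∑ d, G b d * Γ d c a + ∑ d, G a d * Γ d c b)))
    = ∑ a, ∑ b, G a b * (V' a + ∑ c, ∑ d, Γ a c d * f c * V d) * W b
      + ∑ a, ∑ b, G a b * V a * (W' b + ∑ c, ∑ d, Γ b c d * f c * W d) := by
  have h1 : ∑ a, ∑ b, W b * (V a * ∑ c, f c * ∑ d, G b d * Γ d c a)
      = ∑ a, ∑ b, G a b * (∑ c, ∑ d, Γ a c d * f c * V d) * W b := by
    simp only [Finset.mul_sum, Finset.sum_mul]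
    rw [Finset.sum_comm]
    rw [Finset.sum_comm (f := fun a b ↦ ∑ c, ∑ d, G a b * (Γ a c d * f c * V d) * W b)]
    refine Finset.sum_congr rfl fun b _ ↦ ?_
    rw [Finset.sum_comm]
    rw [Finset.sum_comm (f := fun a c ↦ ∑ d, G a b * (Γ a c d * f c * V d) * W b)]
    refine Finset.sum_congr rfl fun c _ ↦ ?_
    rw [Finset.sum_comm]
    refine Finset.sum_congr rfl fun a _ ↦ Finset.sum_congr rfl fun d _ ↦ ?_
    rw [hG a b]
    ring
  have h2 : ∑ a, ∑ b, W b * (V a * ∑ c, f c * ∑ d, G a d * Γ d c b)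
      = ∑ a, ∑ b, G a b * V a * (∑ c, ∑ d, Γ b c d * f c * W d) := by
    simp only [Finset.mul_sum]
    refine Finset.sum_congr rfl fun a _ ↦ ?_
    rw [Finset.sum_comm]
    rw [Finset.sum_comm (f := fun b c ↦ ∑ d, G a b * V a * (Γ b c d * f c * W d))]
    refine Finset.sum_congr rfl fun c _ ↦ ?_
    rw [Finset.sum_comm]
    refine Finset.sum_congr rfl fun b _ ↦ Finset.sum_congr rfl fun d _ ↦ ?_
    ring
  simp only [mul_add, add_mul, Finset.sum_add_distrib, h1, h2]
  have h3 : ∑ a, ∑ b, W b * (G a b * V' a) = ∑ a, ∑ b, G a b * V' a * W b :=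
    Finset.sum_congr rfl fun a _ ↦ Finset.sum_congr rfl fun b _ ↦ by ring
  rw [h3]
  ring

/-- The Levi-Civita covariant derivative along a map is compatible with the metric. -/
theorem Spacetime.hasFDerivAt_metric (g : Spacetime M) {F : E → M}
    {V W : Π y : E, TangentSpace (𝓡 4) (F y)} {p : E}
    (hV : MDifferentiableAt 𝓘(ℝ, E) (𝓡 4).tangent
      (fun y ↦ (⟨F y, V y⟩ : TangentBundle (𝓡 4) M)) p)
    (hW : MDifferentiableAt 𝓘(ℝ, E) (𝓡 4).tangent
      (fun y ↦ (⟨F y, W y⟩ : TangentBundle (𝓡 4) M)) p) :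
    ∃ D : E →L[ℝ] ℝ, HasFDerivAt (fun x ↦ g.metric (F x) (V x) (W x)) D p ∧
      ∀ u, D u = g.metric (F p) (g.covDeriv 𝓘(ℝ, E) F V p u) (W p)
        + g.metric (F p) (V p) (g.covDeriv 𝓘(ℝ, E) F W p u) := by
  have hF := mdifferentiableAt_base hV
  -- One fixed chart serves a whole neighbourhood of `p`, so the inner product can be differentiated
  -- there by the ordinary product rule.
  have hev : (fun x ↦ g.metric (F x) (V x) (W x)) =ᶠ[nhds p] fun x ↦ ∑ a, ∑ b,
      g.coeff (F p) (extChartAt (𝓡 4) (F p) (F x)) a b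
        * chartComp (F p) (V x) a * chartComp (F p) (W x) b := by
    filter_upwards [hF.continuousAt.preimage_mem_nhds (chart_source_mem_nhds E4 (F p))] with x hx
    exact g.metric_eq_sum_coeff (F p) hx (V x) (W x)
  have hf : DifferentiableAt ℝ (fun z ↦ extChartAt (𝓡 4) (F p) (F z)) p :=
    ((mdifferentiableAt_extChartAt (I := 𝓡 4) (mem_chart_source E4 (F p))).comp p hF
      ).differentiableAt
  have hG : ∀ a b, HasFDerivAt (fun x ↦ g.coeff (F p) (extChartAt (𝓡 4) (F p) (F x)) a b)
      ((fderiv ℝ (fun y ↦ g.coeff (F p) y a b) (extChartAt (𝓡 4) (F p) (F p))).comp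
        (fderiv ℝ (fun z ↦ extChartAt (𝓡 4) (F p) (F z)) p)) p := fun a b ↦
    HasFDerivAt.comp (g := fun y ↦ g.coeff (F p) y a b) p
      ((g.contDiffAt_coeff (F p) a b).differentiableAt (by simp)).hasFDerivAt hf.hasFDerivAt
  have hVc : ∀ a, HasFDerivAt (fun x ↦ chartComp (F p) (V x) a) _ p := fun a ↦
    (EuclideanSpace.proj (𝕜 := ℝ) a).hasFDerivAt.comp p
      (differentiableAt_chartComp hV).hasFDerivAt
  have hWc : ∀ a, HasFDerivAt (fun x ↦ chartComp (F p) (W x) a) _ p := fun a ↦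
    (EuclideanSpace.proj (𝕜 := ℝ) a).hasFDerivAt.comp p
      (differentiableAt_chartComp hW).hasFDerivAt
  refine ⟨_, (HasFDerivAt.fun_sum fun a _ ↦ HasFDerivAt.fun_sum fun b _ ↦
    ((hG a b).mul (hVc a)).mul (hWc b)).congr_of_eventuallyEq hev, fun u ↦ ?_⟩
  rw [g.metric_eq_sum_coeff (F p) (mem_chart_source E4 _),
    g.metric_eq_sum_coeff (F p) (mem_chart_source E4 _),
    chartComp_self (F p) (g.covDeriv 𝓘(ℝ, E) F V p u),
    chartComp_self (F p) (g.covDeriv 𝓘(ℝ, E) F W p u)]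
  simp only [g.covDeriv_apply _ hF]
  rw [← sum_metric_compatibility _ (g.coeff_symm (F p) _)]
  simp only [sum_apply, add_apply, smul_apply, smul_eq_mul, ContinuousLinearMap.comp_apply,
    fderiv_eq_sum_partialDeriv, g.partialDeriv_coeff]
  rfl

/-- The covariant derivative differentiates these components once more, so agreement is needed on a
neighbourhood and not only at `p`. -/
theorem eventually_chartComp_mfderiv {F : E → M} {p : E} (hF : ContMDiffAt 𝓘(ℝ, E) (𝓡 4) ∞ F p)
    (v : E) : (fun z ↦ chartComp (F p) (mfderiv 𝓘(ℝ, E) (𝓡 4) F z v)) =ᶠ[nhds p]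
      fun z ↦ fderiv ℝ (fun z ↦ extChartAt (𝓡 4) (F p) (F z)) z v := by
  have h1 := (contMDiffAt_iff_contMDiffAt_nhds (by simp)).1 (hF.of_le (show (1 : ℕ∞ω) ≤ ∞ by simp))
  filter_upwards [h1, hF.continuousAt.preimage_mem_nhds (chart_source_mem_nhds E4 (F p))]
    with z hz hz'
  exact chartComp_mfderiv (hz.mdifferentiableAt (by simp)) hz' v

/-- The image of a constant vector field under the differential of a smooth map is smooth. -/
theorem contMDiffAt_mfderiv_const_apply {F : E → M} {p : E}
    (hF : ContMDiffAt 𝓘(ℝ, E) (𝓡 4) ∞ F p) (v : E) :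
    ContMDiffAt 𝓘(ℝ, E) (𝓡 4).tangent ∞
      (fun z ↦ (⟨F z, mfderiv 𝓘(ℝ, E) (𝓡 4) F z v⟩ : TangentBundle (𝓡 4) M)) p := by
  refine Bundle.contMDiffAt_totalSpace.2 ⟨hF, ?_⟩
  refine ContMDiffAt.congr_of_eventuallyEq ?_ (eventually_chartComp_mfderiv hF v)
  exact (((contDiffAt_extChartAt_comp hF).fderiv_right (m := ∞) (by simp)).clm_apply
    contDiffAt_const).contMDiffAt

/-- Displays the Hessian of the coordinate expression and the Christoffel term separately. Both are
symmetric in `u` and `v`, and for maps constant along rays both can be evaluated at `v = p`. -/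
theorem Spacetime.covDeriv_mfderiv_apply (g : Spacetime M) {F : E → M} {p : E}
    (hF : ContMDiffAt 𝓘(ℝ, E) (𝓡 4) ∞ F p) (u v : E) (c : Fin 4) :
    (show E4 from g.covDeriv 𝓘(ℝ, E) F (fun z ↦ mfderiv 𝓘(ℝ, E) (𝓡 4) F z v) p u) c
      = fderiv ℝ (fderiv ℝ (fun z ↦ extChartAt (𝓡 4) (F p) (F z))) p u v c
        + ∑ a, ∑ b, g.christoffel (F p) c a b (extChartAt (𝓡 4) (F p) (F p))
          * fderiv ℝ (fun z ↦ extChartAt (𝓡 4) (F p) (F z)) p u a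
          * fderiv ℝ (fun z ↦ extChartAt (𝓡 4) (F p) (F z)) p v b := by
  rw [g.covDeriv_apply _ (hF.mdifferentiableAt (by simp)),
    (eventually_chartComp_mfderiv hF v).fderiv_eq,
    chartComp_mfderiv (hF.mdifferentiableAt (by simp)) (mem_chart_source E4 (F p)),
    fderiv_clm_apply (((contDiffAt_extChartAt_comp hF).fderiv_right (m := ∞)
      (by simp)).differentiableAt (by simp)) (differentiableAt_const v)]
  simp

/-- The Levi-Civita connection is torsion free along maps. -/
theorem Spacetime.covDeriv_mfderiv_comm (g : Spacetime M) {F : E → M} {p : E}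
    (hF : ContMDiffAt 𝓘(ℝ, E) (𝓡 4) ∞ F p) (u v : E) :
    g.covDeriv 𝓘(ℝ, E) F (fun z ↦ mfderiv 𝓘(ℝ, E) (𝓡 4) F z v) p u
      = g.covDeriv 𝓘(ℝ, E) F (fun z ↦ mfderiv 𝓘(ℝ, E) (𝓡 4) F z u) p v := by
  refine PiLp.ext (x := (show E4 from g.covDeriv 𝓘(ℝ, E) F _ p u))
    (y := (show E4 from g.covDeriv 𝓘(ℝ, E) F _ p v)) fun c ↦ ?_
  rw [g.covDeriv_mfderiv_apply hF, g.covDeriv_mfderiv_apply hF,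
    (contDiffAt_extChartAt_comp hF).isSymmSndFDerivAt (by simpa using ENat.LEInfty.out) u v,
    Finset.sum_comm]
  congr 1
  refine Finset.sum_congr rfl fun a _ ↦ Finset.sum_congr rfl fun b _ ↦ ?_
  rw [g.christoffel_symm]
  ring

/-- If `F` is constant along rays near `p`, then `∇_u (dF p) = - dF u` at `p`, where `p` is
regarded as a constant vector field. -/
theorem Spacetime.covDeriv_mfderiv_radial (g : Spacetime M) {F : E → M} {p : E}
    (hF : ContMDiffAt 𝓘(ℝ, E) (𝓡 4) ∞ F p)
    (hr : ∀ᶠ z in nhds p, mfderiv 𝓘(ℝ, E) (𝓡 4) F z z = 0) (u : E) :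
    g.covDeriv 𝓘(ℝ, E) F (fun z ↦ mfderiv 𝓘(ℝ, E) (𝓡 4) F z p) p u
      = - mfderiv 𝓘(ℝ, E) (𝓡 4) F p u := by
  have hd := hF.mdifferentiableAt (show (∞ : ℕ∞ω) ≠ 0 by simp)
  set f : E → E4 := fun z ↦ extChartAt (𝓡 4) (F p) (F z) with hf
  have hr' : (fun z ↦ fderiv ℝ f z z) =ᶠ[nhds p] fun _ ↦ 0 := by
    have h1 := (contMDiffAt_iff_contMDiffAt_nhds (by simp)).1
      (hF.of_le (show (1 : ℕ∞ω) ≤ ∞ by simp))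
    filter_upwards [hr, h1, hF.continuousAt.preimage_mem_nhds (chart_source_mem_nhds E4 (F p))]
      with z hz hz1 hz2
    rw [← chartComp_mfderiv (hz1.mdifferentiableAt (by simp)) hz2, hz,
      chartComp_eq_mfderiv _ hz2, map_zero]
    rfl
  have hp : fderiv ℝ f p p = 0 := hr'.self_of_nhds
  have hD : DifferentiableAt ℝ (fderiv ℝ f) p :=
    ((contDiffAt_extChartAt_comp hF).fderiv_right (m := ∞) (by simp)).differentiableAt (by simp)
  -- Differentiate `f'(z) z = 0` at `z = p` in the direction `u`: the product rule gives `f''(u, p)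
  -- + f'(u) = 0`.
  have h2 : fderiv ℝ (fderiv ℝ f) p u p = - fderiv ℝ f p u := by
    have := congrArg (fun A : E →L[ℝ] E4 ↦ A u) hr'.fderiv_eq
    rw [fderiv_clm_apply hD differentiableAt_fun_id] at this
    simp at this
    exact eq_neg_of_add_eq_zero_right this
  rw [mfderiv_apply_eq_fderiv hd]
  refine PiLp.ext (x := (show E4 from g.covDeriv 𝓘(ℝ, E) F _ p u)) (y := -fderiv ℝ f p u)
    fun c ↦ ?_
  rw [g.covDeriv_mfderiv_apply hF, ← hf, h2, hp]
  simp

/-- The chain rule for covariant derivatives along maps. -/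
theorem Spacetime.covDeriv_comp (g : Spacetime M) {E' G N : Type*} [NormedAddCommGroup E']
    [NormedSpace ℝ E'] [TopologicalSpace G] {J : ModelWithCorners ℝ E' G} [TopologicalSpace N]
    [ChartedSpace G N] {F : N → M} {V : Π y : N, TangentSpace (𝓡 4) (F y)} {P : E → N} {p : E}
    (hP : MDifferentiableAt 𝓘(ℝ, E) J P p)
    (hV : MDifferentiableAt J (𝓡 4).tangent
      (fun y ↦ (⟨F y, V y⟩ : TangentBundle (𝓡 4) M)) (P p)) (u : E) :
    g.covDeriv 𝓘(ℝ, E) (fun z ↦ F (P z)) (fun z ↦ V (P z)) p u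
      = g.covDeriv J F V (P p) (mfderiv 𝓘(ℝ, E) J P p u) := by
  obtain ⟨h1, h2⟩ := (mdifferentiableAt_totalSpace _ _).1 hV
  have e1 := mfderiv_comp p h1 hP
  have e2 := mfderiv_comp p h2 hP
  have e1' : mfderiv 𝓘(ℝ, E) (𝓡 4) (fun z ↦ F (P z)) p u
      = mfderiv J (𝓡 4) F (P p) (mfderiv 𝓘(ℝ, E) J P p u) :=
    congrArg (fun A : E →L[ℝ] E4 ↦ A u) e1
  have e2' : mfderiv 𝓘(ℝ, E) 𝓘(ℝ, E4) (fun z ↦ chartComp (F (P p)) (V (P z))) p u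
      = mfderiv J 𝓘(ℝ, E4) (fun z ↦ chartComp (F (P p)) (V z)) (P p)
        (mfderiv 𝓘(ℝ, E) J P p u) :=
    congrArg (fun A : E →L[ℝ] E4 ↦ A u) e2
  have key : ∀ (A B : E4) (C D : TangentSpace (𝓡 4) (F (P p))), A = B → C = D →
      (A + WithLp.toLp 2 fun c ↦ ∑ a, ∑ b,
        g.christoffel (F (P p)) c a b (extChartAt (𝓡 4) (F (P p)) (F (P p)))
          * comp C a * comp (V (P p)) b : E4)
      = B + WithLp.toLp 2 fun c ↦ ∑ a, ∑ b,
        g.christoffel (F (P p)) c a b (extChartAt (𝓡 4) (F (P p)) (F (P p)))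
          * comp D a * comp (V (P p)) b := by
    rintro A B C D rfl rfl
    rfl
  exact key _ _ _ _ e2' e1'

end AlongMaps

/-! ### A divergence theorem for fields tangent to spheres -/

section Divergence

open MeasureTheory

/-- Integration by parts against the constant function `1`. -/
theorem integral_fderiv_apply_eq_zero {E : Type*} [NormedAddCommGroup E] [NormedSpace ℝ E]
    [FiniteDimensional ℝ E] [MeasurableSpace E] [BorelSpace E] (μ : Measure E)
    [μ.IsAddHaarMeasure] {f : E → ℝ} (hf : ContDiff ℝ 1 f) (hc : HasCompactSupport f) (v : E) :
    ∫ x, fderiv ℝ f x v ∂μ = 0 := by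
  have h := integral_mul_fderiv_eq_neg_fderiv_mul_of_integrable (μ := μ) (f := fun _ : E ↦ (1 : ℝ))
    (g := f) (v := v) (by simp) ?_ ?_ (fun x _ ↦ differentiableAt_const _)
    (fun x _ ↦ hf.differentiable (by simp) x)
  · simpa using h
  · simp only [one_mul]
    exact ((hf.continuous_fderiv (by simp)).clm_apply
      continuous_const).integrable_of_hasCompactSupport
      (hc.fderiv_apply (𝕜 := ℝ) v)
  · simpa using hf.continuous.integrable_of_hasCompactSupport hc

/-- A vector field on punctured Euclidean space that is tangent to the spheres around the origin
has a point of vanishing divergence. -/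
theorem exists_divergence_eq_zero {ι : Type*} [Fintype ι] [Nontrivial ι]
    {Y : EuclideanSpace ℝ ι → EuclideanSpace ℝ ι} (hY : ∀ x ≠ 0, ContDiffAt ℝ 1 Y x)
    (hr : ∀ x, ∑ i, x i * Y x i = 0) :
    ∃ x ≠ 0, ∑ i, fderiv ℝ Y x (EuclideanSpace.basisFun ι ℝ i) i = 0 := by
  classical
  set D : EuclideanSpace ℝ ι → ℝ :=
    fun x ↦ ∑ i, fderiv ℝ Y x (EuclideanSpace.basisFun ι ℝ i) i with hD
  by_contra! hne
  have hDc : ContinuousOn D {0}ᶜ := by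
    intro x hx
    refine ContinuousAt.continuousWithinAt ?_
    have h1 : ContinuousAt (fderiv ℝ Y) x :=
      ((hY x hx).fderiv_right (m := 0) (by simp)).continuousAt
    refine tendsto_finsetSum _ fun i _ ↦ ?_
    exact (EuclideanSpace.proj (𝕜 := ℝ) i).continuous.continuousAt.comp
      (h1.clm_apply continuousAt_const)
  have hconn : IsPreconnected ({0}ᶜ : Set (EuclideanSpace ℝ ι)) := by
    refine (isConnected_compl_singleton_of_one_lt_rank ?_ 0).isPreconnected
    rw [← Module.finrank_eq_rank, finrank_euclideanSpace]
    exact_mod_cast Fintype.one_lt_card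
  -- A continuous function without zeros on a connected set has constant sign; the value `D x₀`
  -- itself serves as the sign factor.
  obtain ⟨s, hs⟩ : ∃ s : ℝ, ∀ x ≠ 0, 0 < s * D x := by
    obtain ⟨x₀, hx₀⟩ := exists_ne (0 : EuclideanSpace ℝ ι)
    refine ⟨D x₀, fun x hx ↦ ?_⟩
    by_contra! hle
    have hI := hconn.intermediate_value (a := x) (b := x₀) hx hx₀
      (hDc.const_smul (D x₀) : ContinuousOn (fun y ↦ D x₀ * D y) _)
    obtain ⟨y, hy, hy0⟩ := hI ⟨hle, mul_self_nonneg _⟩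
    rcases mul_eq_zero.1 hy0 with h | h
    · exact hne _ hx₀ h
    · exact hne _ hy h
  -- Evaluated at `‖x‖ ^ 2`, this bump is `1` on the unit sphere and vanishes both near the origin,
  -- where `Y` is uncontrolled, and at infinity.
  let φ : ContDiffBump (1 : ℝ) := ⟨1 / 4, 1 / 2, by norm_num, by norm_num⟩
  set χ : EuclideanSpace ℝ ι → ℝ := fun x ↦ φ (‖x‖ ^ 2) with hχ
  have hχd : ContDiff ℝ 1 χ := φ.contDiff.comp (contDiff_norm_sq ℝ)
  have hχz : ∀ᶠ x in nhds (0 : EuclideanSpace ℝ ι), χ x = 0 := by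
    have h : ∀ᶠ x in nhds (0 : EuclideanSpace ℝ ι), ‖x‖ ^ 2 < 1 / 4 :=
      (continuous_norm.pow 2).continuousAt.eventually_lt continuousAt_const (by norm_num)
    filter_upwards [h] with x hx
    refine φ.zero_of_le_dist ?_
    rw [Real.dist_eq, abs_sub_comm, abs_of_pos (by linarith)]
    change (1 / 2 : ℝ) ≤ _
    linarith
  have hχc : HasCompactSupport χ := by
    refine HasCompactSupport.intro (isCompact_closedBall (0 : EuclideanSpace ℝ ι) 2) fun x hx ↦ ?_
    rw [mem_closedBall_zero_iff, not_le] at hx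
    refine φ.zero_of_le_dist ?_
    have : 4 < ‖x‖ ^ 2 := by nlinarith
    rw [Real.dist_eq, abs_of_pos (by linarith)]
    change (1 / 2 : ℝ) ≤ _
    linarith
  -- The gradient of the cutoff is radial, hence orthogonal to `Y`, so multiplying by `χ` merely
  -- multiplies the divergence by `χ`.
  have hχ' : ∀ x, ∃ c : ℝ, ∀ i, fderiv ℝ χ x (EuclideanSpace.basisFun ι ℝ i) = c * x i := by
    intro x
    refine ⟨deriv φ (‖x‖ ^ 2) * 2, fun i ↦ ?_⟩
    have h1 : HasFDerivAt χ (deriv φ (‖x‖ ^ 2) • (2 • (innerSL ℝ x))) x :=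
      HasDerivAt.comp_hasFDerivAt (h₂ := φ) (f := fun x : EuclideanSpace ℝ ι ↦ ‖x‖ ^ 2) x
        ((φ.contDiff (n := 1)).differentiable (by simp) (‖x‖ ^ 2)).hasDerivAt
        (hasStrictFDerivAt_norm_sq x).hasFDerivAt
    rw [h1.fderiv]
    simp [EuclideanSpace.inner_single_right]
    ring
  have hZ : ∀ i, ContDiff ℝ 1 fun x ↦ χ x * Y x i := by
    intro i
    rw [contDiff_iff_contDiffAt]
    intro x
    by_cases hx : x = 0
    · subst hx
      refine (contDiffAt_const (c := (0 : ℝ))).congr_of_eventuallyEq ?_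
      filter_upwards [hχz] with x hx
      simp [hx]
    · exact hχd.contDiffAt.mul ((EuclideanSpace.proj (𝕜 := ℝ) i).contDiff.contDiffAt.comp x
        (hY x hx))
  have hZc : ∀ i, HasCompactSupport fun x ↦ χ x * Y x i := fun i ↦ hχc.mul_right
  have hdiv : ∀ x, ∑ i, fderiv ℝ (fun x ↦ χ x * Y x i) x (EuclideanSpace.basisFun ι ℝ i)
      = χ x * D x := by
    intro x
    by_cases hx : x = 0
    · subst hx
      rw [hχz.self_of_nhds, zero_mul]
      refine Finset.sum_eq_zero fun i _ ↦ ?_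
      have : (fun x ↦ χ x * Y x i) =ᶠ[nhds 0] fun _ ↦ 0 := by
        filter_upwards [hχz] with x hx
        simp [hx]
      rw [this.fderiv_eq]
      simp
    · obtain ⟨c, hc⟩ := hχ' x
      have hYd : DifferentiableAt ℝ Y x := (hY x hx).differentiableAt (by simp)
      have h1 : ∀ i, fderiv ℝ (fun x ↦ χ x * Y x i) x (EuclideanSpace.basisFun ι ℝ i)
          = χ x * fderiv ℝ Y x (EuclideanSpace.basisFun ι ℝ i) i + c * (x i * Y x i) := by
        intro i
        have h2 : HasFDerivAt (fun x ↦ Y x i) _ x :=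
          (EuclideanSpace.proj (𝕜 := ℝ) i).hasFDerivAt.comp x hYd.hasFDerivAt
        rw [((hχd.differentiable (by simp) x).hasFDerivAt.fun_mul h2).fderiv, add_apply, smul_apply,
          smul_apply, hc i, smul_eq_mul, smul_eq_mul]
        change χ x * fderiv ℝ Y x (EuclideanSpace.basisFun ι ℝ i) i + _ = _
        ring
      simp only [h1, Finset.sum_add_distrib, ← Finset.mul_sum, hr, mul_zero, add_zero, hD]
  have hχD : Continuous fun x ↦ χ x * D x := by
    simp_rw [← hdiv]
    exact continuous_finsetSum _ fun i _ ↦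
      ((hZ i).continuous_fderiv (by simp)).clm_apply continuous_const
  have hint : ∫ x, χ x * D x = 0 := by
    simp_rw [← hdiv]
    rw [integral_finsetSum]
    · exact Finset.sum_eq_zero fun i _ ↦ integral_fderiv_apply_eq_zero _ (hZ i) (hZc i) _
    · exact fun i _ ↦ (((hZ i).continuous_fderiv (by simp)).clm_apply
        continuous_const).integrable_of_hasCompactSupport ((hZc i).fderiv_apply (𝕜 := ℝ) _)
  obtain ⟨i₀⟩ : Nonempty ι := inferInstance
  have hpos : 0 < ∫ x, s * (χ x * D x) := by
    refine Continuous.integral_pos_of_hasCompactSupport_nonneg_nonzero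
      (x := EuclideanSpace.single i₀ 1) (continuous_const.mul hχD) (hχc.mul_right.mul_left)
      (fun x ↦ ?_) ?_
    · by_cases hx : x = 0
      · simp [hx, hχz.self_of_nhds]
      · have h1 := hs x hx
        have h2 : 0 ≤ χ x := φ.nonneg
        calc (0 : ℝ) ≤ χ x * (s * D x) := by positivity
          _ = _ := by ring
    · have h0 : EuclideanSpace.single i₀ (1 : ℝ) ≠ 0 := by simp
      have h1 := hs _ h0
      have h2 : χ (EuclideanSpace.single i₀ 1) = 1 := by
        refine φ.one_of_mem_closedBall ?_
        simp [φ.rIn_pos.le]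
      rw [h2, one_mul]
      exact h1.ne'
  rw [integral_const_mul, hint, mul_zero] at hpos
  exact lt_irrefl _ hpos

end Divergence

/-! ### Densities attached to a degenerate form of rank two -/

section Hodge

variable {E : Type*} [NormedAddCommGroup E] [InnerProductSpace ℝ E]

/-- Expand one basis in the other and use Parseval. Values in a general `W` cover scalar traces as
well as vector sums such as `∑ θ (b i) • b i`. -/
theorem sum_apply_orthonormalBasis {ι κ W : Type*} [Fintype ι] [Fintype κ] [AddCommGroup W]
    [Module ℝ W] (b : OrthonormalBasis ι ℝ E) (c : OrthonormalBasis κ ℝ E)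
    (B : E →ₗ[ℝ] E →ₗ[ℝ] W) : ∑ i, B (b i) (b i) = ∑ j, B (c j) (c j) := by
  classical
  have h : ∀ i, B (b i) (b i) = ∑ j, ∑ k, (inner ℝ (c j) (b i) * inner ℝ (b i) (c k)) •
      B (c j) (c k) := fun i ↦ by
    conv_lhs => rw [← c.sum_repr' (b i)]
    simp only [map_sum, map_smul, LinearMap.sum_apply, LinearMap.smul_apply, Finset.smul_sum,
      smul_smul]
    rw [Finset.sum_comm]
    refine Finset.sum_congr rfl fun j _ ↦ Finset.sum_congr rfl fun k _ ↦ ?_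
    rw [real_inner_comm (c k), mul_comm]
  simp_rw [h]
  rw [Finset.sum_comm]
  refine Finset.sum_congr rfl fun j _ ↦ ?_
  rw [Finset.sum_comm]
  simp_rw [← Finset.sum_smul, b.sum_inner_mul_inner, c.inner_eq_ite, ite_smul, one_smul,
    zero_smul]
  simp

/-- For a degenerate symmetric form `H` of rank two on a three-dimensional space, the number `√(σ₂)`
where `σ₂` is the second elementary symmetric function of the eigenvalues: the area density. -/
def areaDensity (H : Matrix (Fin 3) (Fin 3) ℝ) : ℝ :=
  √((1 / 2) * ((∑ i, H i i) ^ 2 - ∑ i, ∑ j, H i j ^ 2))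

/-- The components of the vector density that is metrically dual to the covector `T` with respect
to the degenerate form `H` of rank two. -/
def dualDensity (H : Matrix (Fin 3) (Fin 3) ℝ) (T : Fin 3 → ℝ) (i : Fin 3) : ℝ :=
  (areaDensity H)⁻¹ * ((∑ j, H j j) * T i - ∑ j, H i j * T j)

/-- The trace and the sum of squared entries are both invariant; for the latter, change the basis
one slot at a time. -/
theorem areaDensity_eq_areaDensity (b c : OrthonormalBasis (Fin 3) ℝ E) (h : E →ₗ[ℝ] E →ₗ[ℝ] ℝ) :
    areaDensity (.of fun i j ↦ h (b i) (b j)) = areaDensity (.of fun i j ↦ h (c i) (c j)) := by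
  have h2 : ∑ i, ∑ j, h (b i) (b j) ^ 2 = ∑ i, ∑ j, h (c i) (c j) ^ 2 := by
    have e1 : ∀ u, ∑ j, h u (b j) ^ 2 = ∑ j, h u (c j) ^ 2 := fun u ↦ by
      simpa [sq] using sum_apply_orthonormalBasis b c ((LinearMap.mul ℝ ℝ).compl₁₂ (h u) (h u))
    have e2 : ∀ v, ∑ i, h (b i) v ^ 2 = ∑ i, h (c i) v ^ 2 := fun v ↦ by
      simpa [sq] using sum_apply_orthonormalBasis b c
        ((LinearMap.mul ℝ ℝ).compl₁₂ (h.flip v) (h.flip v))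
    simp_rw [e1]
    rw [Finset.sum_comm]
    simp_rw [e2]
    exact Finset.sum_comm
  simp only [areaDensity, Matrix.of_apply, h2, sum_apply_orthonormalBasis b c h]

/-- Every ingredient is a contraction over an orthonormal basis. The field can thus be defined in
the standard basis and differentiated at each point in a basis adapted to the radial direction, so
no smooth frame of the sphere is needed. -/
theorem sum_dualDensity_smul (b c : OrthonormalBasis (Fin 3) ℝ E) (h : E →ₗ[ℝ] E →ₗ[ℝ] ℝ)
    (θ : E →ₗ[ℝ] ℝ) :
    ∑ i, dualDensity (.of fun i j ↦ h (b i) (b j)) (fun i ↦ θ (b i)) i • b i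
      = ∑ i, dualDensity (.of fun i j ↦ h (c i) (c j)) (fun i ↦ θ (c i)) i • c i := by
  have h1 := sum_apply_orthonormalBasis b c h
  have h2 := areaDensity_eq_areaDensity b c h
  have h3 : ∑ i, θ (b i) • b i = ∑ i, θ (c i) • c i := by
    simpa using sum_apply_orthonormalBasis b c ((LinearMap.lsmul ℝ E).compl₁₂ θ LinearMap.id)
  have h4 : ∑ i, (∑ j, h (b i) (b j) * θ (b j)) • b i
      = ∑ i, (∑ j, h (c i) (c j) * θ (c j)) • c i := by
    have e1 : ∀ u, ∑ j, h u (b j) * θ (b j) = ∑ j, h u (c j) * θ (c j) := fun u ↦ by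
      simpa using sum_apply_orthonormalBasis b c ((LinearMap.mul ℝ ℝ).compl₁₂ (h u) θ)
    simp_rw [e1, Finset.sum_smul]
    rw [Finset.sum_comm]
    conv_rhs => rw [Finset.sum_comm]
    refine Finset.sum_congr rfl fun j _ ↦ ?_
    simp_rw [mul_comm _ (θ (c j)), mul_smul, ← Finset.smul_sum]
    congr 1
    simpa using sum_apply_orthonormalBasis b c
      ((LinearMap.lsmul ℝ E).compl₁₂ (h.flip (c j)) LinearMap.id)
  have h5 : ∀ d : OrthonormalBasis (Fin 3) ℝ E,
      ∑ i, dualDensity (.of fun i j ↦ h (d i) (d j)) (fun i ↦ θ (d i)) i • d i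
      = (areaDensity (.of fun i j ↦ h (d i) (d j)))⁻¹ •
        ((∑ j, h (d j) (d j)) • ∑ i, θ (d i) • d i
          - ∑ i, (∑ j, h (d i) (d j) * θ (d j)) • d i) := fun d ↦ by
    simp only [dualDensity, Matrix.of_apply]
    rw [Finset.smul_sum, ← Finset.sum_sub_distrib, Finset.smul_sum]
    refine Finset.sum_congr rfl fun i _ ↦ ?_
    rw [mul_smul, sub_smul, mul_smul]
  rw [h5, h5, h1, h2, h3, h4]

/-- The derivative of the area density and of the dual density. -/
theorem hasFDerivAt_dualDensity {H : E → Matrix (Fin 3) (Fin 3) ℝ} {T : E → Fin 3 → ℝ}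
    {H' : Fin 3 → Fin 3 → E →L[ℝ] ℝ} {T' : Fin 3 → E →L[ℝ] ℝ} {p : E}
    (hH : ∀ i j, HasFDerivAt (fun x ↦ H x i j) (H' i j) p)
    (hT : ∀ i, HasFDerivAt (fun x ↦ T x i) (T' i) p) (hμ : 0 < areaDensity (H p)) (i : Fin 3) :
    ∃ D : E →L[ℝ] ℝ, HasFDerivAt (fun x ↦ dualDensity (H x) (T x) i) D p ∧
      ∀ u, D u = (areaDensity (H p))⁻¹ * ((∑ j, H' j j u) * T p i + (∑ j, H p j j) * T' i u
          - ∑ j, (H' i j u * T p j + H p i j * T' j u))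
        - (areaDensity (H p))⁻¹ ^ 3 * (1 / 2)
          * ((∑ j, H p j j) * (∑ j, H' j j u) - ∑ j, ∑ k, H p j k * H' j k u)
          * ((∑ j, H p j j) * T p i - ∑ j, H p i j * T p j) := by
  have htr : HasFDerivAt (fun x ↦ ∑ j, H x j j) (∑ j, H' j j) p :=
    HasFDerivAt.fun_sum fun j _ ↦ hH j j
  have hsq := (((htr.pow 2).fun_sub (HasFDerivAt.fun_sum (u := Finset.univ) fun j _ ↦
    HasFDerivAt.fun_sum (u := Finset.univ) fun k _ ↦ (hH j k).pow 2)).const_mul (1 / 2 : ℝ))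
  -- Positive area density keeps the argument away from the singularity of the square root.
  have hne : (1 / 2 : ℝ) * ((∑ j, H p j j) ^ 2 - ∑ j, ∑ k, H p j k ^ 2) ≠ 0 := fun h ↦ by
    rw [areaDensity, h, Real.sqrt_zero] at hμ
    exact lt_irrefl _ hμ
  have hsqrt : HasFDerivAt (fun x ↦ areaDensity (H x)) _ p := hsq.sqrt hne
  have hinv : HasFDerivAt (fun x ↦ (areaDensity (H x))⁻¹) _ p :=
    (hasDerivAt_inv hμ.ne').comp_hasFDerivAt p hsqrt
  refine ⟨_, hinv.fun_mul ((htr.fun_mul (hT i)).fun_sub (HasFDerivAt.fun_sum fun j _ ↦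
    (hH i j).fun_mul (hT j))), fun u ↦ ?_⟩
  simp only [sum_apply, add_apply, sub_apply, smul_apply, smul_eq_mul,
    Finset.sum_add_distrib]
  have hdef : √(1 / 2 * ((∑ j, H p j j) ^ 2 - ∑ j, ∑ k, H p j k ^ 2)) = areaDensity (H p) := rfl
  have h2 : ∑ j, ∑ k, 2 • H p j k ^ (2 - 1) * H' j k u = 2 * ∑ j, ∑ k, H p j k * H' j k u := by
    simp only [Finset.mul_sum]
    exact Finset.sum_congr rfl fun j _ ↦ Finset.sum_congr rfl fun k _ ↦ by simp; ring
  rw [hdef, h2]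
  generalize ∑ j, ∑ k, H p j k * H' j k u = s
  generalize ∑ j, H p j j = t
  generalize ∑ j, H' j j u = t'
  simp only [mul_comm (T p _) (H' _ _ u)]
  generalize ∑ j, H' i j u * T p j = r₁
  generalize ∑ j, H p i j * T' j u = r₂
  generalize ∑ j, H p i j * T p j = r₃
  field_simp
  simp
  ring

/-- On the tangential block, `tr H - H` is the adjugate of `H`, so the dual density is `μ H⁻¹ T`.
With `f_i` the image of the `i`-th basis vector, `B i j k` stands for `⟨∇_i f_j, f_k⟩`, `X i j` for
`⟨∇_i f_j, ξ⟩`, `K i j` for `⟨∇_i ξ, f_j⟩`, and `N` for the part of `X` due to the normal component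
of `ξ`. The index `2` is radial and contributes nothing; `K` drops out by antisymmetry; the `B`
terms from differentiating `H`, `μ` and `T` cancel. Only the contraction of `N` with the cofactors
of `H` survives. -/
theorem divergence_dualDensity_algebra {H DT X K : Fin 3 → Fin 3 → ℝ} {T : Fin 3 → ℝ}
    {DH B : Fin 3 → Fin 3 → Fin 3 → ℝ} {a b μ ρ : ℝ} (N : Fin 3 → Fin 3 → ℝ)
    (hH : ∀ i j, H i j = H j i) (hH2 : ∀ i, H i 2 = 0) (hT2 : T 2 = 0)
    (hDH : ∀ i j k, DH i j k = B i j k + B i k j) (hB : ∀ i j k, B i j k = B j i k)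
    (hB2 : ∀ i j, B i j 2 = 0) (hBr : ∀ j k, B j 2 k = -ρ * H j k)
    (hDT : ∀ i j, DT i j = X i j + K i j) (hX : ∀ i j, X i j = X j i)
    (hXr : ∀ j, X j 2 = -ρ * T j) (hK : ∀ i j, K i j = - K j i) (hK2 : ∀ i, K i 2 = 0)
    (hT : ∀ j, T j = a * H 0 j + b * H 1 j)
    (hN : ∀ i j, X i j = a * B i j 0 + b * B i j 1 + N i j)
    (hμ : μ ≠ 0) (hμ2 : μ ^ 2 = H 0 0 * H 1 1 - H 0 1 * H 0 1) :
    ∑ i, (μ⁻¹ * ((∑ j, DH i j j) * T i + (∑ j, H j j) * DT i i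
          - ∑ j, (DH i i j * T j + H i j * DT i j))
        - μ⁻¹ ^ 3 * (1 / 2) * ((∑ j, H j j) * (∑ j, DH i j j) - ∑ j, ∑ k, H j k * DH i j k)
          * ((∑ j, H j j) * T i - ∑ j, H i j * T j))
      = μ⁻¹ * (H 1 1 * N 0 0 - H 0 1 * N 0 1 - H 0 1 * N 1 0 + H 0 0 * N 1 1) := by
  have hK0 : K 0 0 = 0 := by linarith [hK 0 0]
  have hK1 : K 1 1 = 0 := by linarith [hK 1 1]
  -- `N` inherits symmetry from `X` and `B`.
  have hN01 : N 1 0 = N 0 1 := by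
    have h := hN 1 0
    rw [hX 1 0, hB 1 0 0, hB 1 0 1] at h
    linarith [hN 0 1]
  have hH20 : H 2 0 = 0 := by rw [hH, hH2]
  have hH21 : H 2 1 = 0 := by rw [hH, hH2]
  have hB20 : ∀ j k, B 2 j k = -ρ * H j k := fun j k ↦ by rw [hB, hBr]
  have hK20 : ∀ j, K 2 j = 0 := fun j ↦ by rw [hK, hK2, neg_zero]
  have hX20 : ∀ j, X 2 j = -ρ * T j := fun j ↦ by rw [hX, hXr]
  simp only [Fin.sum_univ_three, hDH, hDT, hB2, hBr, hB20, hH2, hH20, hH21, hT2, hXr, hX20, hK2,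
    hK20, hK0, hK1, hB 1 0, hX 1 0, hK 1 0, hH 1 0, hN01]
  rw [hN 0 0, hN 0 1, hN 1 1, hT 0, hT 1]
  simp only [hH 1 0]
  generalize H 0 0 = h₀ at *
  generalize H 0 1 = h₁ at *
  generalize H 1 1 = h₂ at *
  generalize B 0 0 0 = b₁
  generalize B 0 0 1 = b₂
  generalize B 0 1 0 = b₃
  generalize B 0 1 1 = b₄
  generalize B 1 1 0 = b₅
  generalize B 1 1 1 = b₆
  generalize N 0 0 = n₁
  generalize N 0 1 = n₂
  generalize N 1 1 = n₃
  generalize K 0 1 = κ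
  clear hH hH2 hT2 hDH hB hB2 hBr hDT hX hXr hK hK2 hT hN hK0 hK1 hN01 hH20 hH21 hB20 hK20 hX20
  field_simp
  rw [hμ2]
  ring

theorem contDiffAt_dualDensity {H : E → Matrix (Fin 3) (Fin 3) ℝ} {T : E → Fin 3 → ℝ} {p : E}
    {n : ℕ∞ω} (hH : ∀ i j, ContDiffAt ℝ n (fun x ↦ H x i j) p)
    (hT : ∀ i, ContDiffAt ℝ n (fun x ↦ T x i) p) (hμ : 0 < areaDensity (H p)) (i : Fin 3) :
    ContDiffAt ℝ n (fun x ↦ dualDensity (H x) (T x) i) p := by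
  have htr : ContDiffAt ℝ n (fun x ↦ ∑ j, H x j j) p := ContDiffAt.sum fun j _ ↦ hH j j
  have hne : (1 / 2 : ℝ) * ((∑ j, H p j j) ^ 2 - ∑ j, ∑ k, H p j k ^ 2) ≠ 0 := fun h ↦ by
    rw [areaDensity, h, Real.sqrt_zero] at hμ
    exact lt_irrefl _ hμ
  refine ContDiffAt.mul (ContDiffAt.inv (ContDiffAt.sqrt ?_ hne) hμ.ne') ?_
  · exact contDiffAt_const.mul ((htr.pow 2).sub (ContDiffAt.sum fun j _ ↦
      ContDiffAt.sum fun k _ ↦ (hH j k).pow 2))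
  · exact (htr.mul (hT i)).sub (ContDiffAt.sum fun j _ ↦ (hH i j).mul (hT j))

/-- With a vanishing last row and column, the second elementary symmetric function is the remaining
2×2 minor. -/
theorem areaDensity_of_degenerate {H : Matrix (Fin 3) (Fin 3) ℝ} (hH : ∀ i j, H i j = H j i)
    (hH2 : ∀ i, H i 2 = 0) : areaDensity H = √(H 0 0 * H 1 1 - H 0 1 * H 0 1) := by
  rw [areaDensity]
  congr 1
  simp only [Fin.sum_univ_three, hH2, hH 2, hH 1 0]
  ring

end Hodge

/-! ### Adapted frames and traces -/

section LinearAlgebra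

/-- In a four-dimensional space with a nondegenerate symmetric form, a vector is determined by
its components along a spacelike plane and along a normalized pair of null normals. -/
theorem exists_eq_tangent_add_normal {W : Type*} [AddCommGroup W] [Module ℝ W]
    (hW : Module.finrank ℝ W = 4) (B : W →ₗ[ℝ] W →ₗ[ℝ] ℝ) (hB : ∀ v w, B v w = B w v)
    (hnd : ∀ w, (∀ v, B v w = 0) → w = 0) {f₀ f₁ k k' : W}
    (hf : B f₀ f₀ * B f₁ f₁ - B f₀ f₁ * B f₀ f₁ ≠ 0) (hk : B k k = 0) (hk' : B k' k' = 0)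
    (hkk' : B k k' = -1) (h0 : B k f₀ = 0) (h1 : B k f₁ = 0) (h0' : B k' f₀ = 0)
    (h1' : B k' f₁ = 0) (x : W) :
    ∃ a b : ℝ, x = a • f₀ + b • f₁ - B x k' • k - B x k • k' := by
  set δ := B f₀ f₀ * B f₁ f₁ - B f₀ f₁ * B f₀ f₁ with hδ
  have s0 := hB f₀ k
  have s1 := hB f₁ k
  have s0' := hB f₀ k'
  have s1' := hB f₁ k'
  have s01 := hB f₁ f₀
  have sk := hB k' k
  rw [h0] at s0
  rw [h1] at s1
  rw [h0'] at s0'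
  rw [h1'] at s1'
  rw [hkk'] at sk
  -- Pairing a relation with `k` and `k'` isolates the coefficients of `k'` and `k`; pairing with
  -- `f₀`, `f₁` leaves a 2×2 system with determinant `δ`.
  have hli : LinearIndependent ℝ ![f₀, f₁, k, k'] := by
    rw [Fintype.linearIndependent_iff]
    intro c hc
    simp only [Fin.sum_univ_four, Matrix.cons_val] at hc
    have e0 := congrArg (B f₀) hc
    have e1 := congrArg (B f₁) hc
    have ek := congrArg (B k) hc
    have ek' := congrArg (B k') hc
    simp only [map_add, map_smul, smul_eq_mul, map_zero, h0, h1, h0', h1', s0, s1, s0', s1', s01,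
      sk, hk, hk', hkk', mul_zero, add_zero, zero_add, mul_neg, mul_one,
      neg_eq_zero] at e0 e1 ek ek'
    have c0 : c 0 * δ = 0 := by rw [hδ]; linear_combination B f₁ f₁ * e0 - B f₀ f₁ * e1
    have c1 : c 1 * δ = 0 := by rw [hδ]; linear_combination B f₀ f₀ * e1 - B f₀ f₁ * e0
    intro i
    fin_cases i
    · exact (mul_eq_zero.1 c0).resolve_right hf
    · exact (mul_eq_zero.1 c1).resolve_right hf
    · exact ek'
    · exact ek
  -- Cramer's rule for the Gram system of `f₀`, `f₁`. The remainder is then orthogonal to a basis,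
  -- hence zero.
  refine ⟨(B x f₀ * B f₁ f₁ - B x f₁ * B f₀ f₁) / δ, (B x f₁ * B f₀ f₀ - B x f₀ * B f₀ f₁) / δ, ?_⟩
  rw [← sub_eq_zero]
  refine hnd _ fun v ↦ ?_
  set w := x - _ with hw
  have hb := (basisOfLinearIndependentOfCardEqFinrank hli (by simp [hW])).ext
    (f₁ := B.flip w) (f₂ := 0) ?_
  · exact congrArg (fun f ↦ f v) hb
  · intro i
    rw [coe_basisOfLinearIndependentOfCardEqFinrank, LinearMap.flip_apply, LinearMap.zero_apply, hw]
    fin_cases i <;>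
    simp only [map_add, map_sub, map_smul, smul_eq_mul, h0, h1, h0', h1', s0, s1, s0', s1', s01,
      sk, hk, hk', hkk', Matrix.cons_val, Fin.zero_eta, Fin.mk_one, Fin.reduceFinMk, hB x]
    · field_simp
      rw [hδ]
      ring
    · field_simp
      rw [hδ]
      ring
    · ring
    · ring

/-- The trace of a bilinear form with respect to another one does not depend on the frame. -/
theorem sum_inv_mul_congr {n : Type*} [Fintype n] [DecidableEq n] (P q L : Matrix n n ℝ)
    (hP : IsUnit P.det) :
    ∑ i, ∑ j, (P * q * Pᵀ)⁻¹ i j * (P * L * Pᵀ) i j = ∑ i, ∑ j, q⁻¹ i j * L i j := by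
  have htr : ∀ A B : Matrix n n ℝ, ∑ i, ∑ j, A i j * B i j = (Aᵀ * B).trace := fun A B ↦ by
    simp only [Matrix.trace, Matrix.diag, Matrix.mul_apply, Matrix.transpose_apply]
    exact Finset.sum_comm
  have hPt : IsUnit Pᵀ.det := by rwa [Matrix.det_transpose]
  rw [htr, htr, Matrix.mul_inv_rev, Matrix.mul_inv_rev, Matrix.transpose_mul,
    Matrix.transpose_mul, ← Matrix.transpose_nonsing_inv, Matrix.transpose_transpose]
  rw [Matrix.mul_assoc, Matrix.mul_assoc, Matrix.mul_assoc, ← Matrix.mul_assoc P⁻¹,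
    Matrix.nonsing_inv_mul _ hP, Matrix.one_mul, Matrix.trace_mul_comm, Matrix.mul_assoc,
    Matrix.mul_assoc, Matrix.transpose_nonsing_inv P, Matrix.mul_nonsing_inv _ hPt, Matrix.mul_one]

end LinearAlgebra

/-! ### Timelike against null vectors -/

section Lorentz

variable {M : Type*} [TopologicalSpace M] [ChartedSpace E4 M] [IsManifold (𝓡 4) ∞ M]

/-- If `v` and `k` were orthogonal, Cauchy–Schwarz on spatial parts would give `(v₀² - |v⃗|²) k₀² ≤
0`. Since `v` is timelike this forces `k₀ = 0`, and a null vector without time component vanishes.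
-/
theorem Spacetime.metric_ne_zero_of_timelike_of_null (g : Spacetime M) {x : M}
    {v k : TangentSpace (𝓡 4) x} (hv : g.metric x v v < 0) (hk : g.metric x k k = 0)
    (hk0 : k ≠ 0) : g.metric x v k ≠ 0 := by
  obtain ⟨b, hb⟩ := g.signature x
  have key : ∀ v w, g.metric x v w = - (b.repr v 0 * b.repr w 0) + b.repr v 1 * b.repr w 1
      + b.repr v 2 * b.repr w 2 + b.repr v 3 * b.repr w 3 := fun v w ↦ by
    conv_lhs => rw [← b.sum_repr v, ← b.sum_repr w]
    simp only [map_sum, sum_apply, map_smul, smul_apply, smul_eq_mul, hb]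
    simp [Fin.sum_univ_four]
    ring
  intro h0
  rw [key] at hv hk h0
  have hk₀ : b.repr k 0 = 0 := by
    have h1 : (b.repr v 1 * b.repr k 1 + b.repr v 2 * b.repr k 2 + b.repr v 3 * b.repr k 3) ^ 2
        ≤ (b.repr v 1 ^ 2 + b.repr v 2 ^ 2 + b.repr v 3 ^ 2)
          * (b.repr k 1 ^ 2 + b.repr k 2 ^ 2 + b.repr k 3 ^ 2) := by
      nlinarith [sq_nonneg (b.repr v 1 * b.repr k 2 - b.repr v 2 * b.repr k 1),
        sq_nonneg (b.repr v 1 * b.repr k 3 - b.repr v 3 * b.repr k 1),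
        sq_nonneg (b.repr v 2 * b.repr k 3 - b.repr v 3 * b.repr k 2)]
    rw [show b.repr v 1 * b.repr k 1 + b.repr v 2 * b.repr k 2 + b.repr v 3 * b.repr k 3
      = b.repr v 0 * b.repr k 0 by linarith,
      show b.repr k 1 ^ 2 + b.repr k 2 ^ 2 + b.repr k 3 ^ 2 = b.repr k 0 ^ 2 by linarith] at h1
    have h2 : (b.repr v 0 ^ 2 - (b.repr v 1 ^ 2 + b.repr v 2 ^ 2 + b.repr v 3 ^ 2))
        * b.repr k 0 ^ 2 ≤ 0 := by linarith
    have h3 : b.repr k 0 ^ 2 ≤ 0 := by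
      by_contra! h
      nlinarith
    exact pow_eq_zero_iff (two_ne_zero) |>.1 (le_antisymm h3 (sq_nonneg _))
  rw [hk₀] at hk
  refine hk0 (b.ext_elem fun i ↦ ?_)
  rw [map_zero, Finsupp.zero_apply]
  fin_cases i
  · exact hk₀
  · change b.repr k 1 = 0
    nlinarith [sq_nonneg (b.repr k 2), sq_nonneg (b.repr k 3)]
  · change b.repr k 2 = 0
    nlinarith [sq_nonneg (b.repr k 1), sq_nonneg (b.repr k 3)]
  · change b.repr k 3 = 0
    nlinarith [sq_nonneg (b.repr k 2), sq_nonneg (b.repr k 1)]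

end Lorentz

/-! ### Frame independence of the expansion -/

section Expansion

variable {M : Type*} [TopologicalSpace M] [ChartedSpace E4 M] [IsManifold (𝓡 4) ∞ M]

/-- `covDeriv` is a bare function of the direction; packaging its linearity allows directions to be
expanded in a frame. -/
theorem Spacetime.exists_covDeriv_eq (g : Spacetime M) {E G N : Type*} [NormedAddCommGroup E]
    [NormedSpace ℝ E] [TopologicalSpace G] (J : ModelWithCorners ℝ E G) [TopologicalSpace N]
    [ChartedSpace G N] (F : N → M) (V : Π y : N, TangentSpace (𝓡 4) (F y)) (y : N) :
    ∃ D : TangentSpace J y →ₗ[ℝ] TangentSpace (𝓡 4) (F y), ∀ u, D u = g.covDeriv J F V y u := by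
  let C : E4 →ₗ[ℝ] E4 :=
    { toFun := fun B ↦ WithLp.toLp 2 fun c ↦ ∑ a, ∑ b,
        g.christoffel (F y) c a b (extChartAt (𝓡 4) (F y) (F y)) * B a * comp (V y) b
      map_add' := fun B B' ↦ by
        ext c
        simp [mul_add, add_mul, Finset.sum_add_distrib]
      map_smul' := fun r B ↦ by
        ext c
        simp only [PiLp.smul_apply, smul_eq_mul, RingHom.id_apply, Finset.mul_sum]
        exact Finset.sum_congr rfl fun a _ ↦ Finset.sum_congr rfl fun b _ ↦ by ring }
  let A : E →L[ℝ] E4 := mfderiv J 𝓘(ℝ, E4)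
    (fun z ↦ (trivializationAt E4 (TangentSpace (𝓡 4) : M → Type _) (F y)
      (⟨F z, V z⟩ : TangentBundle (𝓡 4) M)).2) y
  let B : E →L[ℝ] E4 := mfderiv J (𝓡 4) F y
  exact ⟨(A.toLinearMap + C.comp B.toLinearMap : E →ₗ[ℝ] E4), fun u ↦ rfl⟩

variable {N : Type*} [TopologicalSpace N] [ChartedSpace (EuclideanSpace ℝ (Fin 2)) N]

/-- The expansion may be computed in any frame of the surface. -/
theorem Spacetime.expansion_eq_of_frame (g : Spacetime M) (σ : N → M)
    (k : Π y : N, TangentSpace (𝓡 4) (σ y)) (y : N) (u : Fin 2 → TangentSpace (𝓡 2) y)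
    (hu : LinearIndependent ℝ u) (q L : Matrix (Fin 2) (Fin 2) ℝ)
    (hq : ∀ i j, q i j = g.metric (σ y) (mfderiv (𝓡 2) (𝓡 4) σ y (u i))
      (mfderiv (𝓡 2) (𝓡 4) σ y (u j)))
    (hL : ∀ i j, L i j = g.metric (σ y) (g.covDeriv (𝓡 2) σ k y (u i))
      (mfderiv (𝓡 2) (𝓡 4) σ y (u j))) :
    g.expansion σ k y = ∑ i, ∑ j, q⁻¹ i j * L i j := by
  obtain ⟨D, hD⟩ := g.exists_covDeriv_eq (𝓡 2) σ k y
  set P : Matrix (Fin 2) (Fin 2) ℝ := .of fun i j ↦ (show EuclideanSpace ℝ (Fin 2) from u i) j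
  have hsum : ∀ i, u i = ∑ a, P i a • surfVec y a := fun i ↦ by
    refine PiLp.ext (x := (show EuclideanSpace ℝ (Fin 2) from u i)) (y :=
      (∑ a, P i a • (EuclideanSpace.single a (1 : ℝ)) : EuclideanSpace ℝ (Fin 2))) fun c ↦ ?_
    fin_cases c <;> simp [P]
  have hP : IsUnit P.det := by
    rw [← Matrix.isUnit_iff_isUnit_det, ← Matrix.linearIndependent_rows_iff_isUnit]
    exact hu.map' (WithLp.linearEquiv 2 ℝ (Fin 2 → ℝ)).toLinearMap (LinearEquiv.ker _)
  have hq' : q = P * g.surfMetric σ y * Pᵀ := by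
    ext i j
    rw [hq, hsum i, hsum j]
    simp only [map_sum, map_smul, sum_apply, smul_apply, smul_eq_mul, Matrix.mul_apply,
      Matrix.transpose_apply, Spacetime.surfMetric, Matrix.of_apply, Finset.mul_sum,
      Finset.sum_mul]
    refine Finset.sum_congr rfl fun a _ ↦ Finset.sum_congr rfl fun b _ ↦ by ring
  have hL' : L = P * g.surfDeriv σ k y * Pᵀ := by
    ext i j
    rw [hL, ← hD, hsum i, hsum j]
    simp only [map_sum, map_smul, sum_apply, smul_apply, smul_eq_mul, Matrix.mul_apply,
      Matrix.transpose_apply, Spacetime.surfDeriv, Matrix.of_apply, Finset.mul_sum,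
      Finset.sum_mul]
    simp only [hD]
    refine Finset.sum_congr rfl fun a _ ↦ Finset.sum_congr rfl fun b _ ↦ by ring
  rw [hq', hL', sum_inv_mul_congr _ _ _ hP]
  rfl

end Expansion

/-! ### The radial projection onto the sphere -/

section Sphere

/-- Three-dimensional Euclidean space. -/
abbrev E3 : Type := EuclideanSpace ℝ (Fin (2 + 1))

instance : Fact (Module.finrank ℝ E3 = 2 + 1) := ⟨finrank_euclideanSpace_fin⟩

theorem norm_inv_smul_mem_sphere {x : E3} (hx : x ≠ 0) : ‖x‖⁻¹ • x ∈ Metric.sphere (0 : E3) 1 := by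
  rw [mem_sphere_zero_iff_norm, norm_smul, norm_inv, norm_norm,
    inv_mul_cancel₀ (norm_ne_zero_iff.2 hx)]

open Classical in
/-- The radial projection of punctured space onto the sphere. -/
def radialProj (x : E3) : TwoSphere :=
  if hx : x = 0 then ⟨EuclideanSpace.single 0 1, by simp⟩
  else ⟨‖x‖⁻¹ • x, norm_inv_smul_mem_sphere hx⟩

theorem coe_radialProj {x : E3} (hx : x ≠ 0) : (radialProj x : E3) = ‖x‖⁻¹ • x := by
  simp [radialProj, hx]

theorem eventually_coe_radialProj {p : E3} (hp : p ≠ 0) :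
    (fun x ↦ (radialProj x : E3)) =ᶠ[nhds p] fun x ↦ ‖x‖⁻¹ • x := by
  filter_upwards [isOpen_ne.mem_nhds hp] with x hx using coe_radialProj hx

theorem contDiffAt_norm_inv_smul {p : E3} (hp : p ≠ 0) :
    ContDiffAt ℝ ∞ (fun x : E3 ↦ ‖x‖⁻¹ • x) p :=
  ((contDiffAt_norm ℝ hp).inv (norm_ne_zero_iff.2 hp)).smul contDiffAt_id

theorem contMDiffAt_radialProj {p : E3} (hp : p ≠ 0) :
    ContMDiffAt 𝓘(ℝ, E3) (𝓡 2) ∞ radialProj p := by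
  have hco : ContDiffAt ℝ ∞ (fun x ↦ (radialProj x : E3)) p :=
    (contDiffAt_norm_inv_smul hp).congr_of_eventuallyEq (eventually_coe_radialProj hp)
  rw [contMDiffAt_iff_target]
  refine ⟨Topology.IsInducing.subtypeVal.continuousAt_iff.2 hco.continuousAt, ?_⟩
  set v := radialProj p with hv
  let U : _ ≃ₗᵢ[ℝ] _ :=
    (OrthonormalBasis.fromOrthogonalSpanSingleton (𝕜 := ℝ)
        2 (ne_zero_of_mem_unit_sphere (-v))).repr
  -- The chart at `v` is stereographic projection from `-v`, smooth in the ambient space near `v`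
  -- because `⟨-v, v⟩ = -1 ≠ 1`.
  have h1 : ContDiffAt ℝ ∞ (stereoToFun ((-v : TwoSphere) : E3)) (v : E3) := by
    refine contDiffOn_stereoToFun.contDiffAt (IsOpen.mem_nhds ?_ ?_)
    · exact isOpen_ne_fun (innerSL ℝ _).continuous continuous_const
    · simp
      norm_num
  exact (U.contDiff.contDiffAt.comp p (h1.comp p hco)).contMDiffAt

/-- The derivative of the radial projection, in terms of the inclusion of the sphere. -/
theorem mfderiv_coe_mfderiv_radialProj {p : E3} (hp : p ≠ 0) (u : E3) :
    mfderiv (𝓡 2) 𝓘(ℝ, E3) ((↑) : TwoSphere → E3) (radialProj p)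
      (mfderiv 𝓘(ℝ, E3) (𝓡 2) radialProj p u) = fderiv ℝ (fun x : E3 ↦ ‖x‖⁻¹ • x) p u := by
  rw [← (eventually_coe_radialProj hp).fderiv_eq, ← mfderiv_eq_fderiv]
  have h1 : MDifferentiableAt (𝓡 2) 𝓘(ℝ, E3) ((↑) : TwoSphere → E3) (radialProj p) :=
    (contMDiff_coe_sphere (m := 1) (n := 2) _).mdifferentiableAt one_ne_zero
  have h := mfderiv_comp p h1 ((contMDiffAt_radialProj hp).mdifferentiableAt (by simp))
  exact (congrArg (fun A : E3 →L[ℝ] E3 ↦ A u) h).symm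

theorem fderiv_norm_inv_smul {p : E3} (hp : p ≠ 0) (u : E3) :
    fderiv ℝ (fun x : E3 ↦ ‖x‖⁻¹ • x) p u = ‖p‖⁻¹ • u - (‖p‖⁻¹ ^ 3 * inner ℝ p u) • p := by
  have hn : ‖p‖ ≠ 0 := norm_ne_zero_iff.2 hp
  have h1 : HasFDerivAt (fun x : E3 ↦ √(‖x‖ ^ 2)) _ p :=
    (hasStrictFDerivAt_norm_sq p).hasFDerivAt.sqrt (pow_ne_zero 2 hn)
  simp only [Real.sqrt_sq (norm_nonneg _)] at h1
  have h2 : HasFDerivAt (fun x : E3 ↦ ‖x‖⁻¹) _ p := (hasDerivAt_inv hn).comp_hasFDerivAt p h1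
  have h3 : HasFDerivAt (fun x : E3 ↦ ‖x‖⁻¹ • x) _ p := h2.fun_smul (hasFDerivAt_id p)
  rw [h3.fderiv]
  simp [smul_smul, sub_eq_add_neg]
  congr 1
  field_simp

/-- On the orthogonal complement of `p`, the derivative of `x / ‖x‖` is multiplication by `‖p‖⁻¹`.
-/
theorem mfderiv_radialProj_ne_zero {p u : E3} (hp : p ≠ 0) (hu : u ≠ 0) (hpu : inner ℝ p u = 0) :
    mfderiv 𝓘(ℝ, E3) (𝓡 2) radialProj p u ≠ 0 := fun h ↦ by
  have h1 := mfderiv_coe_mfderiv_radialProj hp u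
  rw [h, map_zero, fderiv_norm_inv_smul hp, hpu, mul_zero, zero_smul, sub_zero] at h1
  exact smul_ne_zero (inv_ne_zero (norm_ne_zero_iff.2 hp)) hu h1.symm

theorem mfderiv_radialProj_self {p : E3} (hp : p ≠ 0) :
    mfderiv 𝓘(ℝ, E3) (𝓡 2) radialProj p p = 0 := by
  have h1 := mfderiv_coe_mfderiv_radialProj hp p
  have hn : ‖p‖ ≠ 0 := norm_ne_zero_iff.2 hp
  rw [fderiv_norm_inv_smul hp, real_inner_self_eq_norm_sq,
    show ‖p‖⁻¹ ^ 3 * ‖p‖ ^ 2 = ‖p‖⁻¹ by field_simp, sub_self] at h1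
  exact injective_mvfderiv_subtypeVal_sphere (n := 2) (radialProj p)
    (h1.trans (map_zero (mfderiv (𝓡 2) 𝓘(ℝ, E3) ((↑) : TwoSphere → E3) (radialProj p))).symm)

end Sphere

/-! ### The tangential density of a Killing field and its divergence -/

section TangentDensity

variable {M : Type*} [TopologicalSpace M] [ChartedSpace E4 M] [IsManifold (𝓡 4) ∞ M]

/-- The differential of a map, as a linear map on Euclidean space. -/
def differential (F : E3 → M) (x : E3) : E3 →L[ℝ] TangentSpace (𝓡 4) (F x) :=
  mfderiv 𝓘(ℝ, E3) (𝓡 4) F x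

/-- The bilinear form induced by the metric along a map. -/
def Spacetime.inducedForm (g : Spacetime M) (F : E3 → M) (x : E3) : E3 →ₗ[ℝ] E3 →ₗ[ℝ] ℝ :=
  LinearMap.mk₂ ℝ (fun u v : E3 ↦ g.metric (F x) (differential F x u) (differential F x v))
    (fun u u' v ↦ by rw [map_add, map_add, add_apply])
    (fun r u v ↦ by rw [map_smul, map_smul, smul_apply])
    (fun u v v' ↦ by rw [map_add, map_add])
    (fun r u v ↦ by rw [map_smul, map_smul])

/-- The pullback of a vector field along a map, as a one-form. -/
def Spacetime.inducedCovector (g : Spacetime M) (F : E3 → M) (ξ : Π x : M, TangentSpace (𝓡 4) x)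
    (x : E3) : E3 →ₗ[ℝ] ℝ where
  toFun u := g.metric (F x) (differential F x u) (ξ (F x))
  map_add' u v := by rw [map_add, map_add, add_apply]
  map_smul' r u := by rw [map_smul, map_smul, smul_apply]; rfl

/-- The tangential part of the vector field `ξ` along `F`, as a vector density. -/
def Spacetime.tangentDensity (g : Spacetime M) (F : E3 → M) (ξ : Π x : M, TangentSpace (𝓡 4) x)
    (x : E3) : E3 :=
  ∑ i, dualDensity
    (.of fun i j ↦ g.inducedForm F x (EuclideanSpace.basisFun (Fin (2 + 1)) ℝ i)
      (EuclideanSpace.basisFun (Fin (2 + 1)) ℝ j))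
    (fun i ↦ g.inducedCovector F ξ x (EuclideanSpace.basisFun (Fin (2 + 1)) ℝ i)) i
      • EuclideanSpace.basisFun (Fin (2 + 1)) ℝ i

theorem Spacetime.tangentDensity_eq (g : Spacetime M) (F : E3 → M)
    (ξ : Π x : M, TangentSpace (𝓡 4) x) (b : OrthonormalBasis (Fin 3) ℝ E3) (x : E3) :
    g.tangentDensity F ξ x = ∑ i, dualDensity (.of fun i j ↦ g.inducedForm F x (b i) (b j))
      (fun i ↦ g.inducedCovector F ξ x (b i)) i • b i :=
  sum_dualDensity_smul _ _ _ _

theorem Spacetime.contDiffAt_metric (g : Spacetime M) {F : E3 → M}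
    {V W : Π y : E3, TangentSpace (𝓡 4) (F y)} {p : E3}
    (hV : ContMDiffAt 𝓘(ℝ, E3) (𝓡 4).tangent ∞
      (fun y ↦ (⟨F y, V y⟩ : TangentBundle (𝓡 4) M)) p)
    (hW : ContMDiffAt 𝓘(ℝ, E3) (𝓡 4).tangent ∞
      (fun y ↦ (⟨F y, W y⟩ : TangentBundle (𝓡 4) M)) p) :
    ContDiffAt ℝ ∞ (fun x ↦ g.metric (F x) (V x) (W x)) p := by
  have hF : ContMDiffAt 𝓘(ℝ, E3) (𝓡 4) ∞ F p := (Bundle.contMDiffAt_totalSpace.1 hV).1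
  have h := ((g.contMDiff_metric.contMDiffAt (x := F p)).comp p hF).clm_bundle_apply₂ (F₃ := ℝ)
    (E₃ := Bundle.Trivial M ℝ) (b := F) hV hW
  exact (Bundle.contMDiffAt_totalSpace.1 h).2.contDiffAt

theorem Spacetime.contDiffAt_tangentDensity (g : Spacetime M) {F : E3 → M}
    {ξ : Π x : M, TangentSpace (𝓡 4) x} {p : E3} (hF : ContMDiffAt 𝓘(ℝ, E3) (𝓡 4) ∞ F p)
    (hξ : ContMDiffAt (𝓡 4) (𝓡 4).tangent ∞
      (fun x ↦ (⟨x, ξ x⟩ : TangentBundle (𝓡 4) M)) (F p))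
    (b : OrthonormalBasis (Fin 3) ℝ E3)
    (hμ : 0 < areaDensity (.of fun i j ↦ g.inducedForm F p (b i) (b j))) :
    ContDiffAt ℝ ∞ (g.tangentDensity F ξ) p := by
  rw [funext (g.tangentDensity_eq F ξ b)]
  refine ContDiffAt.sum fun i _ ↦ ContDiffAt.fun_smul ?_ contDiffAt_const
  refine contDiffAt_dualDensity (H := fun x ↦ .of fun i j ↦ g.inducedForm F x (b i) (b j))
    (T := fun x i ↦ g.inducedCovector F ξ x (b i)) (fun i j ↦ ?_) (fun i ↦ ?_) hμ i
  · exact g.contDiffAt_metric (contMDiffAt_mfderiv_const_apply hF (b i))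
      (contMDiffAt_mfderiv_const_apply hF (b j))
  · exact g.contDiffAt_metric (contMDiffAt_mfderiv_const_apply hF (b i)) (hξ.comp p hF)

/-- The vector `x` lies in the kernel of `dF`, so the induced form and the induced covector both
annihilate it. -/
theorem Spacetime.sum_mul_tangentDensity (g : Spacetime M) {F : E3 → M}
    {ξ : Π x : M, TangentSpace (𝓡 4) x} {x : E3} (hx : mfderiv 𝓘(ℝ, E3) (𝓡 4) F x x = 0) :
    ∑ i, x i * g.tangentDensity F ξ x i = 0 := by
  have hx' : differential F x x = 0 := hx
  set e := EuclideanSpace.basisFun (Fin (2 + 1)) ℝ with he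
  have hsum : ∑ i, x i • e i = x := by
    ext j
    fin_cases j <;> simp [he, Fin.sum_univ_three]
  have h1 : ∑ i, x i * g.inducedCovector F ξ x (e i) = 0 := by
    calc _ = g.inducedCovector F ξ x (∑ i, x i • e i) := by simp
      _ = g.metric (F x) (differential F x x) (ξ (F x)) := by rw [hsum]; rfl
      _ = 0 := by rw [hx', map_zero, zero_apply]
  have h2 : ∀ v, ∑ i, x i * g.inducedForm F x (e i) v = 0 := fun v ↦ by
    calc _ = g.inducedForm F x (∑ i, x i • e i) v := by simp
      _ = g.metric (F x) (differential F x x) (differential F x v) := by rw [hsum]; rfl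
      _ = 0 := by rw [hx', map_zero, zero_apply]
  have hc : ∀ i, g.tangentDensity F ξ x i = dualDensity
      (.of fun i j ↦ g.inducedForm F x (e i) (e j)) (fun i ↦ g.inducedCovector F ξ x (e i)) i :=
    fun i ↦ by
      rw [Spacetime.tangentDensity, ← he]
      fin_cases i <;> simp [he, Fin.sum_univ_three]
  have key : ∀ (x θ : Fin 3 → ℝ) (h : Fin 3 → Fin 3 → ℝ) (μ : ℝ),
      ∑ i, x i * (μ * ((∑ j, h j j) * θ i - ∑ j, h i j * θ j))
        = μ * ((∑ j, h j j) * ∑ i, x i * θ i - ∑ j, (∑ i, x i * h i j) * θ j) :=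
    fun x θ h μ ↦ by
      simp only [Fin.sum_univ_three]
      ring
  simp only [hc, dualDensity, Matrix.of_apply]
  refine (key (fun i ↦ x i) (fun i ↦ g.inducedCovector F ξ x (e i))
    (fun i j ↦ g.inducedForm F x (e i) (e j)) _).trans ?_
  have h3 : ∑ j, (∑ i, x i * g.inducedForm F x (e i) (e j)) * g.inducedCovector F ξ x (e j) = 0 :=
    Finset.sum_eq_zero fun j _ ↦ by rw [h2, zero_mul]
  rw [show (∑ i : Fin 3, x i * g.inducedCovector F ξ x (e i)) = 0 from h1, mul_zero, zero_sub,
    show (∑ j : Fin 3, (∑ i : Fin 3, x i * g.inducedForm F x (e i) (e j))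
      * g.inducedCovector F ξ x (e j)) = 0 from h3, neg_zero, mul_zero]

/-- For a field `l` of normals along `F`, the second fundamental form is minus the derivative
of `l`. -/
theorem Spacetime.metric_covDeriv_differential (g : Spacetime M) {F : E3 → M} {p : E3}
    (hF : ContMDiffAt 𝓘(ℝ, E3) (𝓡 4) ∞ F p) {l : Π y : E3, TangentSpace (𝓡 4) (F y)}
    (hl : MDifferentiableAt 𝓘(ℝ, E3) (𝓡 4).tangent
      (fun y ↦ (⟨F y, l y⟩ : TangentBundle (𝓡 4) M)) p)
    (hn : ∀ᶠ z in nhds p, ∀ u, g.metric (F z) (l z) (differential F z u) = 0) (u v : E3) :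
    g.metric (F p) (g.covDeriv 𝓘(ℝ, E3) F (fun z ↦ differential F z v) p u) (l p)
      = - g.metric (F p) (g.covDeriv 𝓘(ℝ, E3) F l p u) (differential F p v) := by
  obtain ⟨D, hD, hDu⟩ := g.hasFDerivAt_metric hl
    ((contMDiffAt_mfderiv_const_apply hF v).mdifferentiableAt (by simp))
  -- Normality holds near `p`, so this product is locally zero; compatibility with the metric then
  -- moves the derivative from `dF v` onto `l`.
  have h0 : HasFDerivAt (fun x ↦ g.metric (F x) (l x) (differential F x v))
      (0 : E3 →L[ℝ] ℝ) p := by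
    refine (hasFDerivAt_const (0 : ℝ) p).congr_of_eventuallyEq ?_
    filter_upwards [hn] with z hz using hz v
  have h1 := hDu u
  rw [hD.unique h0, zero_apply] at h1
  rw [g.symm]
  exact (neg_eq_of_add_eq_zero_right h1.symm).symm

theorem Spacetime.exists_metric_eq (g : Spacetime M) {x : M} {f₀ f₁ k k' : TangentSpace (𝓡 4) x}
    (hf : g.metric x f₀ f₀ * g.metric x f₁ f₁ - g.metric x f₀ f₁ * g.metric x f₀ f₁ ≠ 0)
    (hk : g.metric x k k = 0) (hk' : g.metric x k' k' = 0)
    (hkk' : g.metric x k k' = -1) (h0 : g.metric x k f₀ = 0) (h1 : g.metric x k f₁ = 0)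
    (h0' : g.metric x k' f₀ = 0) (h1' : g.metric x k' f₁ = 0) (w : TangentSpace (𝓡 4) x) :
    ∃ a b : ℝ, ∀ v, g.metric x v w = a * g.metric x v f₀ + b * g.metric x v f₁
      - g.metric x w k' * g.metric x v k - g.metric x w k * g.metric x v k' := by
  let B : TangentSpace (𝓡 4) x →ₗ[ℝ] TangentSpace (𝓡 4) x →ₗ[ℝ] ℝ :=
    LinearMap.mk₂ ℝ (fun v w ↦ g.metric x v w)
      (fun u u' v ↦ by rw [map_add, add_apply]) (fun r u v ↦ by rw [map_smul, smul_apply])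
      (fun u v v' ↦ by rw [map_add]) (fun r u v ↦ by rw [map_smul])
  have hfin : Module.finrank ℝ (TangentSpace (𝓡 4) x) = 4 := finrank_euclideanSpace_fin
  obtain ⟨a, b, hab⟩ := exists_eq_tangent_add_normal hfin B (g.symm x)
    (fun w hw ↦ g.eq_zero_of_forall_metric_eq_zero w hw) hf hk hk' hkk' h0 h1 h0' h1' w
  refine ⟨a, b, fun v ↦ ?_⟩
  have h := congrArg (B v) hab
  simp only [map_sub, map_add, map_smul, smul_eq_mul] at h
  exact h

/-- If `F` is constant along rays near `p`, then `∇_p (dF v) = - dF v` at `p`. -/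
theorem Spacetime.covDeriv_differential_radial (g : Spacetime M) {F : E3 → M} {p : E3}
    (hF : ContMDiffAt 𝓘(ℝ, E3) (𝓡 4) ∞ F p)
    (hr : ∀ᶠ z in nhds p, mfderiv 𝓘(ℝ, E3) (𝓡 4) F z z = 0) {ρ : ℝ} {w : E3} (hw : w = ρ • p)
    (v : E3) :
    g.covDeriv 𝓘(ℝ, E3) F (fun z ↦ differential F z w) p v = -ρ • differential F p v := by
  obtain ⟨D, hD⟩ := g.exists_covDeriv_eq 𝓘(ℝ, E3) F (fun z ↦ differential F z v) p
  have h1 : D (ρ • (show TangentSpace 𝓘(ℝ, E3) p from p)) = -ρ • differential F p v := by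
    rw [map_smul, hD, neg_smul, ← smul_neg]
    congr 1
    exact (g.covDeriv_mfderiv_comm hF p v).trans (g.covDeriv_mfderiv_radial hF hr v)
  refine (g.covDeriv_mfderiv_comm hF v w).trans ?_
  rw [hw]
  exact (hD _).symm.trans h1

-- The divergence formula for the tangential part of `ξ`, in a basis whose last vector is radial. By
-- Killing's equation only the second fundamental form paired with the normal part of `ξ` remains.
-- Its components `N` are rewritten through `∇k` and `∇k'`; contracting with the cofactors of `q`
-- over the area density amounts to `√det q` times the trace.
set_option maxHeartbeats 800000 in
theorem Spacetime.sum_inner_fderiv_tangentDensity (g : Spacetime M) {F : E3 → M}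
    {ξ : Π x : M, TangentSpace (𝓡 4) x} {k k' : Π y : E3, TangentSpace (𝓡 4) (F y)} {p : E3}
    (hF : ContMDiffAt 𝓘(ℝ, E3) (𝓡 4) ∞ F p)
    (hr : ∀ᶠ z in nhds p, mfderiv 𝓘(ℝ, E3) (𝓡 4) F z z = 0)
    (hξ : MDifferentiableAt (𝓡 4) (𝓡 4).tangent
      (fun x ↦ (⟨x, ξ x⟩ : TangentBundle (𝓡 4) M)) (F p))
    (hKill : ∀ u v : TangentSpace (𝓡 4) (F p), g.metric (F p) (g.covDeriv (𝓡 4) id ξ (F p) u) v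
      + g.metric (F p) (g.covDeriv (𝓡 4) id ξ (F p) v) u = 0)
    (hk : MDifferentiableAt 𝓘(ℝ, E3) (𝓡 4).tangent
      (fun y ↦ (⟨F y, k y⟩ : TangentBundle (𝓡 4) M)) p)
    (hk' : MDifferentiableAt 𝓘(ℝ, E3) (𝓡 4).tangent
      (fun y ↦ (⟨F y, k' y⟩ : TangentBundle (𝓡 4) M)) p)
    (hn : ∀ᶠ z in nhds p, ∀ u, g.metric (F z) (k z) (differential F z u) = 0)
    (hn' : ∀ᶠ z in nhds p, ∀ u, g.metric (F z) (k' z) (differential F z u) = 0)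
    (hkk : g.metric (F p) (k p) (k p) = 0) (hkk' : g.metric (F p) (k' p) (k' p) = 0)
    (hnorm : g.metric (F p) (k p) (k' p) = -1)
    (b : OrthonormalBasis (Fin 3) ℝ E3) {ρ : ℝ} (hb : b 2 = ρ • p)
    {q : Fin 3 → Fin 3 → ℝ} (hq : ∀ i j, q i j = g.inducedForm F p (b i) (b j))
    {N : Fin 3 → Fin 3 → ℝ} (hN : ∀ i j, N i j
      = g.metric (F p) (ξ (F p)) (k' p)
        * g.metric (F p) (g.covDeriv 𝓘(ℝ, E3) F k p (b i)) (differential F p (b j))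
      + g.metric (F p) (ξ (F p)) (k p)
        * g.metric (F p) (g.covDeriv 𝓘(ℝ, E3) F k' p (b i)) (differential F p (b j)))
    (hpos : 0 < q 0 0 * q 1 1 - q 0 1 * q 0 1) :
    ∑ i, inner ℝ (b i) (fderiv ℝ (g.tangentDensity F ξ) p (b i))
      = (√(q 0 0 * q 1 1 - q 0 1 * q 0 1))⁻¹
        * (q 1 1 * N 0 0 - q 0 1 * N 0 1 - q 0 1 * N 1 0 + q 0 0 * N 1 1) := by
  have hd2 : differential F p (b 2) = 0 := by
    have hp : differential F p p = 0 := hr.self_of_nhds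
    rw [hb, map_smul, hp, smul_zero]
  have hV : ∀ i, MDifferentiableAt 𝓘(ℝ, E3) (𝓡 4).tangent
      (fun z ↦ (⟨F z, differential F z (b i)⟩ : TangentBundle (𝓡 4) M)) p := fun i ↦
    (contMDiffAt_mfderiv_const_apply hF (b i)).mdifferentiableAt (by simp)
  have hξF : MDifferentiableAt 𝓘(ℝ, E3) (𝓡 4).tangent
      (fun z ↦ (⟨F z, ξ (F z)⟩ : TangentBundle (𝓡 4) M)) p :=
    hξ.comp p (hF.mdifferentiableAt (by simp))
  let A : Fin 3 → Fin 3 → TangentSpace (𝓡 4) (F p) := fun i j ↦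
    g.covDeriv 𝓘(ℝ, E3) F (fun z ↦ differential F z (b j)) p (b i)
  have hAsymm : ∀ i j, A i j = A j i := fun i j ↦ g.covDeriv_mfderiv_comm hF (b i) (b j)
  have hA2 : ∀ j, A j 2 = -ρ • differential F p (b j) := fun j ↦
    g.covDeriv_differential_radial hF hr hb (b j)
  have hKeq : ∀ i, g.covDeriv 𝓘(ℝ, E3) F (fun z ↦ ξ (F z)) p (b i)
      = g.covDeriv (𝓡 4) id ξ (F p) (differential F p (b i)) := fun i ↦
    g.covDeriv_comp (F := id) (V := ξ) (hF.mdifferentiableAt (by simp)) hξ (b i)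
  choose H' hH' hH'D using fun i j ↦ g.hasFDerivAt_metric (hV i) (hV j)
  choose T' hT' hT'D using fun i ↦ g.hasFDerivAt_metric (hV i) hξF
  have hq' : ∀ i j, q i j = g.metric (F p) (differential F p (b i)) (differential F p (b j)) := hq
  have hnp := fun u ↦ hn.self_of_nhds u
  have hnp' := fun u ↦ hn'.self_of_nhds u
  -- Here `a` and `c` are the components of `ξ` along the tangent vectors `dF (b 0)` and `dF (b 1)`.
  obtain ⟨a, c, hac⟩ := g.exists_metric_eq (by rw [← hq', ← hq', ← hq']; exact hpos.ne') hkk hkk'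
    hnorm (hnp (b 0)) (hnp (b 1)) (hnp' (b 0)) (hnp' (b 1)) (ξ (F p))
  have harea : areaDensity (.of fun i j ↦ g.inducedForm F p (b i) (b j))
      = √(q 0 0 * q 1 1 - q 0 1 * q 0 1) := by
    rw [areaDensity_of_degenerate]
    · simp only [Matrix.of_apply, hq]
    · exact fun i j ↦ g.symm _ _ _
    · intro i
      change g.metric _ _ (differential F p (b 2)) = 0
      rw [hd2, map_zero]
  have hμ : 0 < √(q 0 0 * q 1 1 - q 0 1 * q 0 1) := Real.sqrt_pos.2 hpos
  choose D hD hDu using hasFDerivAt_dualDensity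
    (H := fun x ↦ .of fun i j ↦ g.inducedForm F x (b i) (b j))
    (T := fun x i ↦ g.inducedCovector F ξ x (b i)) hH' hT' (harea ▸ hμ)
  have hY : ∀ i, inner ℝ (b i) (fderiv ℝ (g.tangentDensity F ξ) p (b i)) = D i (b i) := fun i ↦ by
    have h : HasFDerivAt (g.tangentDensity F ξ) (∑ i, (D i).smulRight (b i)) p := by
      rw [funext (g.tangentDensity_eq F ξ b)]
      exact HasFDerivAt.fun_sum fun i _ ↦ (hD i).smul_const (b i)
    rw [h.fderiv]
    simp [sum_apply, inner_sum, inner_smul_right, b.inner_eq_ite]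
  obtain ⟨t, ht⟩ : ∃ t : Fin 3 → ℝ, ∀ i, t i = g.inducedCovector F ξ p (b i) := ⟨_, fun i ↦ rfl⟩
  have ht' : ∀ i, t i = g.metric (F p) (differential F p (b i)) (ξ (F p)) := ht
  have hDu' : ∀ i, inner ℝ (b i) (fderiv ℝ (g.tangentDensity F ξ) p (b i)) = _ :=
    fun i ↦ (hY i).trans (hDu i (b i))
  simp only [harea] at hDu'
  simp only [Matrix.of_apply, ← hq, ← ht] at hDu'
  obtain ⟨B, hB⟩ : ∃ B : Fin 3 → Fin 3 → Fin 3 → ℝ, ∀ i j l, B i j l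
    = g.metric (F p) (A i j) (differential F p (b l)) := ⟨_, fun i j l ↦ rfl⟩
  obtain ⟨X, hX⟩ : ∃ X : Fin 3 → Fin 3 → ℝ, ∀ i j, X i j
    = g.metric (F p) (A i j) (ξ (F p)) := ⟨_, fun i j ↦ rfl⟩
  obtain ⟨K, hK⟩ : ∃ K : Fin 3 → Fin 3 → ℝ, ∀ i j, K i j = g.metric (F p)
    (g.covDeriv (𝓡 4) id ξ (F p) (differential F p (b i))) (differential F p (b j)) :=
    ⟨_, fun i j ↦ rfl⟩
  have hDH : ∀ i j l, H' j l (b i) = B i j l + B i l j := fun i j l ↦ by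
    rw [hB, hB, hH'D, g.symm (F p) (A i l)]
  have hDT : ∀ i j, T' j (b i) = X i j + K i j := fun i j ↦ by
    rw [hX, hK, hT'D, hKeq, g.symm (F p) (differential F p (b j))]
  rw [Finset.sum_congr rfl fun i _ ↦ hDu' i]
  refine divergence_dualDensity_algebra (ρ := ρ) (a := a) (b := c) (H := q) (T := t) (B := B)
    (X := X) (K := K) (DH := fun i j l ↦ H' j l (b i)) (DT := fun i j ↦ T' j (b i)) N
    ?_ ?_ ?_ hDH ?_ ?_ ?_ hDT ?_ ?_ ?_ ?_ ?_ ?_ hμ.ne' (Real.sq_sqrt hpos.le)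
  · intro i j
    rw [hq', hq', g.symm]
  · intro i
    rw [hq', hd2, map_zero]
  · rw [ht', hd2, map_zero, zero_apply]
  · intro i j l
    rw [hB, hB, hAsymm]
  · intro i j
    rw [hB, hd2, map_zero]
  · intro j l
    rw [hB, hA2, hq', map_smul, smul_apply, smul_eq_mul]
  · intro i j
    rw [hX, hX, hAsymm]
  · intro j
    rw [hX, hA2, ht', map_smul, smul_apply, smul_eq_mul]
  · intro i j
    rw [hK, hK]
    exact eq_neg_of_add_eq_zero_left (hKill _ _)
  · intro i
    rw [hK, hd2, map_zero]
  · intro j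
    rw [ht', hac, g.symm (F p) (differential F p (b j)) (k p),
      g.symm (F p) (differential F p (b j)) (k' p), hnp, hnp', mul_zero, mul_zero,
      sub_zero, sub_zero, hq', hq', g.symm (F p) (differential F p (b j)),
      g.symm (F p) (differential F p (b j)) (differential F p (b 1))]
  · intro i j
    rw [hX, hac, hB, hB, hN, g.metric_covDeriv_differential hF hk hn,
      g.metric_covDeriv_differential hF hk' hn']
    ring

end TangentDensity

/-! ### Marginally trapped spheres in the Killing region -/

section MarginallyTrapped

variable {M : Type*} [TopologicalSpace M] [ChartedSpace E4 M]

theorem sum_inv_mul_fin_two {q : Matrix (Fin 2) (Fin 2) ℝ} (hq : q 1 0 = q 0 1)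
    (hdet : q 0 0 * q 1 1 - q 0 1 * q 0 1 ≠ 0) (L : Matrix (Fin 2) (Fin 2) ℝ) :
    q 1 1 * L 0 0 - q 0 1 * L 0 1 - q 0 1 * L 1 0 + q 0 0 * L 1 1
      = (q 0 0 * q 1 1 - q 0 1 * q 0 1) * ∑ i, ∑ j, q⁻¹ i j * L i j := by
  have hd : q.det = q 0 0 * q 1 1 - q 0 1 * q 0 1 := by rw [Matrix.det_fin_two, hq]
  have h : ∑ i, ∑ j, q⁻¹ i j * L i j = (q 0 0 * q 1 1 - q 0 1 * q 0 1)⁻¹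
      * (q 1 1 * L 0 0 - q 0 1 * L 0 1 - q 0 1 * L 1 0 + q 0 0 * L 1 1) := by
    rw [Matrix.inv_def, Matrix.adjugate_fin_two, hd, Ring.inverse_eq_inv']
    simp [Fin.sum_univ_two, hq]
    ring
  rw [h, mul_inv_cancel_left₀ hdet]

theorem exists_orthonormalBasis_radial {p : E3} (hp : p ≠ 0) :
    ∃ b : OrthonormalBasis (Fin 3) ℝ E3, b 2 = ‖p‖⁻¹ • p := by
  have hv : Orthonormal ℝ (({2} : Set (Fin 3)).domRestrict fun _ ↦ ‖p‖⁻¹ • p) := by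
    refine ⟨fun i ↦ ?_, fun i j hij ↦ absurd (Subsingleton.elim i j) hij⟩
    exact mem_sphere_zero_iff_norm.1 (norm_inv_smul_mem_sphere hp)
  obtain ⟨b, hb⟩ := hv.exists_orthonormalBasis_extension_of_card_eq (by simp)
  exact ⟨b, hb 2 rfl⟩

theorem differential_comp_radialProj {σ : TwoSphere → M} (hσ : ContMDiff (𝓡 2) (𝓡 4) ∞ σ) {z : E3}
    (hz : z ≠ 0) (u : E3) : differential (fun x ↦ σ (radialProj x)) z u
      = mfderiv (𝓡 2) (𝓡 4) σ (radialProj z) (mfderiv 𝓘(ℝ, E3) (𝓡 2) radialProj z u) := by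
  have h := mfderiv_comp z (hσ.contMDiffAt.mdifferentiableAt (by simp))
    ((contMDiffAt_radialProj hz).mdifferentiableAt (by simp))
  exact congrArg (fun A : E3 →L[ℝ] E4 ↦ A u) h

theorem contMDiffAt_comp_radialProj {σ : TwoSphere → M} (hσ : ContMDiff (𝓡 2) (𝓡 4) ∞ σ) {p : E3}
    (hp : p ≠ 0) :
    ContMDiffAt 𝓘(ℝ, E3) (𝓡 4) ∞ (fun x ↦ σ (radialProj x)) p :=
  hσ.contMDiffAt.comp p (contMDiffAt_radialProj hp)

theorem mfderiv_comp_radialProj_self {σ : TwoSphere → M} (hσ : ContMDiff (𝓡 2) (𝓡 4) ∞ σ) {p : E3}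
    (hp : p ≠ 0) :
    mfderiv 𝓘(ℝ, E3) (𝓡 4) (fun x ↦ σ (radialProj x)) p p = 0 := by
  refine (differential_comp_radialProj hσ hp p).trans ?_
  rw [mfderiv_radialProj_self hp, map_zero]

/-- The first two basis vectors span the complement of `p`, on which the differential of the
projection is injective. -/
theorem linearIndependent_mfderiv_radialProj {p : E3} (hp : p ≠ 0)
    {b : OrthonormalBasis (Fin 3) ℝ E3} (hb : b 2 = ‖p‖⁻¹ • p) :
    LinearIndependent ℝ ![mfderiv 𝓘(ℝ, E3) (𝓡 2) radialProj p (b 0),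
      mfderiv 𝓘(ℝ, E3) (𝓡 2) radialProj p (b 1)] := by
  have hpb : p = ‖p‖ • b 2 := by
    rw [hb, smul_smul, mul_inv_cancel₀ (norm_ne_zero_iff.2 hp), one_smul]
  rw [LinearIndependent.pair_iff]
  intro s t hst
  have h : mfderiv 𝓘(ℝ, E3) (𝓡 2) radialProj p (s • b 0 + t • b 1 : E3) = 0 := by
    let D : E3 →L[ℝ] TangentSpace (𝓡 2) (radialProj p) := mfderiv 𝓘(ℝ, E3) (𝓡 2) radialProj p
    change D _ = 0
    rw [map_add, map_smul, map_smul]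
    exact hst
  have h0 : s • b 0 + t • b 1 = 0 := by
    by_contra hne
    refine mfderiv_radialProj_ne_zero hp hne ?_ h
    rw [hpb]
    simp [inner_add_right, inner_smul_left, inner_smul_right, b.inner_eq_ite]
  constructor
  · have := congrArg (inner ℝ (b 0)) h0
    simpa [inner_add_right, inner_smul_right, b.inner_eq_ite] using this
  · have := congrArg (inner ℝ (b 1)) h0
    simpa [inner_add_right, inner_smul_right, b.inner_eq_ite] using this

variable [IsManifold (𝓡 4) ∞ M]

theorem Spacetime.gram_det_pos (g : Spacetime M) {σ : TwoSphere → M} {y : TwoSphere}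
    (hs : ∀ u : TangentSpace (𝓡 2) y, u ≠ 0 →
      0 < g.metric (σ y) (mfderiv (𝓡 2) (𝓡 4) σ y u) (mfderiv (𝓡 2) (𝓡 4) σ y u))
    {u v : TangentSpace (𝓡 2) y} (huv : LinearIndependent ℝ ![u, v]) :
    0 < g.metric (σ y) (mfderiv (𝓡 2) (𝓡 4) σ y u) (mfderiv (𝓡 2) (𝓡 4) σ y u)
        * g.metric (σ y) (mfderiv (𝓡 2) (𝓡 4) σ y v) (mfderiv (𝓡 2) (𝓡 4) σ y v)
      - g.metric (σ y) (mfderiv (𝓡 2) (𝓡 4) σ y u) (mfderiv (𝓡 2) (𝓡 4) σ y v)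
        * g.metric (σ y) (mfderiv (𝓡 2) (𝓡 4) σ y u) (mfderiv (𝓡 2) (𝓡 4) σ y v) := by
  have hv0 : v ≠ 0 := huv.ne_zero 1
  have hv := hs v hv0
  set c := g.metric (σ y) (mfderiv (𝓡 2) (𝓡 4) σ y v) (mfderiv (𝓡 2) (𝓡 4) σ y v) with hc
  set d := g.metric (σ y) (mfderiv (𝓡 2) (𝓡 4) σ y u) (mfderiv (𝓡 2) (𝓡 4) σ y v) with hd
  -- The squared length of `c u - d v` is `c` times the Gram determinant, and `c > 0`.
  have hw : c • u + (-d) • v ≠ 0 := fun h ↦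
    hv.ne' ((LinearIndependent.pair_iff.1 huv) _ _ h).1
  have h1 := hs _ hw
  simp only [map_add, map_smul, add_apply, smul_apply, smul_eq_mul, ← hc, ← hd,
    g.symm (σ y) (mfderiv (𝓡 2) (𝓡 4) σ y v) (mfderiv (𝓡 2) (𝓡 4) σ y u)] at h1
  refine (mul_pos_iff_of_pos_right hv).1 ?_
  linarith

variable {g : Spacetime M} {σ : TwoSphere → M} {k k' : Π y, TangentSpace (𝓡 4) (σ y)}

theorem Spacetime.IsMTS.gram_det_pos (h : g.IsMTS σ k k') {p : E3} (hp : p ≠ 0)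
    {b : OrthonormalBasis (Fin 3) ℝ E3} (hb : b 2 = ‖p‖⁻¹ • p) :
    0 < g.inducedForm (fun x ↦ σ (radialProj x)) p (b 0) (b 0)
        * g.inducedForm (fun x ↦ σ (radialProj x)) p (b 1) (b 1)
      - g.inducedForm (fun x ↦ σ (radialProj x)) p (b 0) (b 1)
        * g.inducedForm (fun x ↦ σ (radialProj x)) p (b 0) (b 1) := by
  have h1 := g.gram_det_pos (h.spacelike (radialProj p))
    (linearIndependent_mfderiv_radialProj hp hb)
  simp only [← differential_comp_radialProj h.embedding.contMDiff hp] at h1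
  exact h1

theorem Spacetime.IsFutureNullNormal.mdifferentiableAt_comp_radialProj
    (h : g.IsFutureNullNormal σ k) {p : E3} (hp : p ≠ 0) :
    MDifferentiableAt 𝓘(ℝ, E3) (𝓡 4).tangent
      (fun y ↦ (⟨σ (radialProj y), k (radialProj y)⟩ : TangentBundle (𝓡 4) M)) p :=
  (h.contMDiff.contMDiffAt.comp p (contMDiffAt_radialProj hp)).mdifferentiableAt (by simp)

/-- The expansion in terms of the radial extension of the surface. -/
theorem Spacetime.IsMTS.gram_det_mul_expansion (h : g.IsMTS σ k k')
    {l : Π y, TangentSpace (𝓡 4) (σ y)} (hl : g.IsFutureNullNormal σ l) {p : E3} (hp : p ≠ 0)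
    {b : OrthonormalBasis (Fin 3) ℝ E3} (hb : b 2 = ‖p‖⁻¹ • p)
    {q L : Fin 3 → Fin 3 → ℝ}
    (hq : ∀ i j, q i j = g.inducedForm (fun x ↦ σ (radialProj x)) p (b i) (b j))
    (hL : ∀ i j, L i j = g.metric (σ (radialProj p))
      (g.covDeriv 𝓘(ℝ, E3) (fun x ↦ σ (radialProj x)) (fun x ↦ l (radialProj x)) p (b i))
      (differential (fun x ↦ σ (radialProj x)) p (b j))) :
    q 1 1 * L 0 0 - q 0 1 * L 0 1 - q 0 1 * L 1 0 + q 0 0 * L 1 1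
      = (q 0 0 * q 1 1 - q 0 1 * q 0 1) * g.expansion σ l (radialProj p) := by
  have hσ := h.embedding.contMDiff
  have hpos := h.gram_det_pos hp hb
  rw [← hq, ← hq, ← hq] at hpos
  have hq' : ∀ i j, q i j = g.metric (σ (radialProj p))
      (mfderiv (𝓡 2) (𝓡 4) σ (radialProj p) (mfderiv 𝓘(ℝ, E3) (𝓡 2) radialProj p (b i)))
      (mfderiv (𝓡 2) (𝓡 4) σ (radialProj p) (mfderiv 𝓘(ℝ, E3) (𝓡 2) radialProj p (b j))) := by
    intro i j
    rw [← differential_comp_radialProj hσ hp, ← differential_comp_radialProj hσ hp]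
    exact hq i j
  have hL' : ∀ i j, L i j = g.metric (σ (radialProj p))
      (g.covDeriv (𝓡 2) σ l (radialProj p) (mfderiv 𝓘(ℝ, E3) (𝓡 2) radialProj p (b i)))
      (mfderiv (𝓡 2) (𝓡 4) σ (radialProj p) (mfderiv 𝓘(ℝ, E3) (𝓡 2) radialProj p (b j))) := by
    intro i j
    rw [← differential_comp_radialProj hσ hp, hL, g.covDeriv_comp
      ((contMDiffAt_radialProj hp).mdifferentiableAt (by simp))
      (hl.contMDiff.contMDiffAt.mdifferentiableAt (by simp))]
  let c : Fin 2 → Fin 3 := Fin.castSucc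
  rw [g.expansion_eq_of_frame σ l (radialProj p) _ (linearIndependent_mfderiv_radialProj hp hb)
    (.of fun i j ↦ q (c i) (c j)) (.of fun i j ↦ L (c i) (c j))
    (by intro i j; fin_cases i <;> fin_cases j <;> exact hq' _ _)
    (by intro i j; fin_cases i <;> fin_cases j <;> exact hL' _ _)]
  exact sum_inv_mul_fin_two (q := .of fun i j ↦ q (c i) (c j))
    (by change q 1 0 = q 0 1; rw [hq', hq', g.symm]) hpos.ne' (.of fun i j ↦ L (c i) (c j))

/-- A marginally trapped sphere in a region with a timelike Killing field has a point where the
other expansion vanishes. -/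
theorem Spacetime.IsMTS.exists_expansion_eq_zero (h : g.IsMTS σ k k') {R : Set M} (hR : IsOpen R)
    {ξ : Π x : M, TangentSpace (𝓡 4) x} (hξ : g.IsKillingOn ξ R)
    (ht : ∀ x ∈ R, g.metric x (ξ x) (ξ x) < 0) (hσR : Set.range σ ⊆ R) :
    ∃ y, g.expansion σ k' y = 0 := by
  by_contra! hne
  have hσ := h.embedding.contMDiff
  have hmem : ∀ y, σ y ∈ R := fun y ↦ hσR ⟨y, rfl⟩
  have hξs : ∀ y, ContMDiffAt (𝓡 4) (𝓡 4).tangent ∞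
      (fun x ↦ (⟨x, ξ x⟩ : TangentBundle (𝓡 4) M)) (σ y) := fun y ↦
    hξ.contMDiffOn.contMDiffAt (hR.mem_nhds (hmem y))
  set F : E3 → M := fun x ↦ σ (radialProj x) with hF
  have hY : ∀ x ≠ 0, ContDiffAt ℝ 1 (g.tangentDensity F ξ) x := by
    intro p hp
    obtain ⟨b, hb⟩ := exists_orthonormalBasis_radial hp
    have hb2 : differential F p (b 2) = 0 := by
      rw [hb, map_smul]
      exact (congrArg _ (mfderiv_comp_radialProj_self hσ hp)).trans (smul_zero _)
    refine (g.contDiffAt_tangentDensity (contMDiffAt_comp_radialProj hσ hp) (hξs _) b ?_).of_le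
      (by simp)
    rw [areaDensity_of_degenerate]
    · exact Real.sqrt_pos.2 (h.gram_det_pos hp hb)
    · intro i j
      exact g.symm _ _ _
    · intro i
      exact (congrArg (g.metric (F p) (differential F p (b i))) hb2).trans (map_zero _)
  have hrad : ∀ x, ∑ i, x i * g.tangentDensity F ξ x i = 0 := by
    intro x
    by_cases hx : x = 0
    · simp [hx]
    · exact g.sum_mul_tangentDensity (mfderiv_comp_radialProj_self hσ hx)
  obtain ⟨p, hp, hdiv⟩ := exists_divergence_eq_zero hY hrad
  obtain ⟨b, hb⟩ := exists_orthonormalBasis_radial hp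
  obtain ⟨q, hq⟩ : ∃ q : Fin 3 → Fin 3 → ℝ, ∀ i j, q i j = g.inducedForm F p (b i) (b j) :=
    ⟨_, fun i j ↦ rfl⟩
  have hpos := h.gram_det_pos hp hb
  rw [← hq, ← hq, ← hq] at hpos
  obtain ⟨L, hL⟩ : ∃ L : (Π y, TangentSpace (𝓡 4) (σ y)) → Fin 3 → Fin 3 → ℝ, ∀ l i j,
      L l i j = g.metric (F p) (g.covDeriv 𝓘(ℝ, E3) F (fun x ↦ l (radialProj x)) p (b i))
        (differential F p (b j)) := ⟨_, fun l i j ↦ rfl⟩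
  have hev : ∀ᶠ z in nhds p, z ≠ 0 := isOpen_ne.mem_nhds hp
  have hn : ∀ l : Π y, TangentSpace (𝓡 4) (σ y), g.IsFutureNullNormal σ l →
      ∀ᶠ z in nhds p, ∀ u, g.metric (F z) (l (radialProj z)) (differential F z u) = 0 := by
    intro l hl
    filter_upwards [hev] with z hz u
    rw [differential_comp_radialProj hσ hz]
    exact hl.normal _ _
  have hsum := g.sum_inner_fderiv_tangentDensity (F := F) (ξ := ξ)
    (k := fun x ↦ k (radialProj x)) (k' := fun x ↦ k' (radialProj x))
    (contMDiffAt_comp_radialProj hσ hp)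
    (by filter_upwards [hev] with z hz using mfderiv_comp_radialProj_self hσ hz)
    ((hξs _).mdifferentiableAt (by simp)) (hξ.killing _ (hmem _))
    (h.nullNormal.mdifferentiableAt_comp_radialProj hp)
    (h.nullNormal'.mdifferentiableAt_comp_radialProj hp) (hn k h.nullNormal) (hn k' h.nullNormal')
    (h.nullNormal.null _) (h.nullNormal'.null _) (h.normalized _) b hb hq
    (N := fun i j ↦ g.metric (F p) (ξ (F p)) (k' (radialProj p)) * L k i j
      + g.metric (F p) (ξ (F p)) (k (radialProj p)) * L k' i j)
    (fun i j ↦ by rw [hL, hL]) hpos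
  have e1 := h.gram_det_mul_expansion h.nullNormal hp hb hq (hL k)
  have e2 := h.gram_det_mul_expansion h.nullNormal' hp hb hq (hL k')
  rw [h.expansion_eq_zero, mul_zero] at e1
  have hξk : g.metric (F p) (ξ (F p)) (k (radialProj p)) ≠ 0 :=
    g.metric_ne_zero_of_timelike_of_null (ht _ (hmem _)) (h.nullNormal.null _)
      (h.nullNormal.future _).1
  -- The Euclidean divergence is a trace, so it may be taken in the adapted basis.
  have hinv : ∑ i, inner ℝ (b i) (fderiv ℝ (g.tangentDensity F ξ) p (b i)) = 0 := by
    have h1 := sum_apply_orthonormalBasis b (EuclideanSpace.basisFun (Fin (2 + 1)) ℝ)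
      ((innerₗ E3).compl₁₂ LinearMap.id (fderiv ℝ (g.tangentDensity F ξ) p).toLinearMap)
    refine h1.trans (Eq.trans (Finset.sum_congr rfl fun i _ ↦ ?_) hdiv)
    simp [EuclideanSpace.inner_single_left]
  rw [hinv] at hsum
  have h0 := (mul_eq_zero.1 hsum.symm).resolve_left (inv_ne_zero (Real.sqrt_pos.2 hpos).ne')
  -- With `Θ_k = 0`, the vanishing divergence says that `(ξ·k) · det q · Θ_k'` is zero, although
  -- none of the factors is.
  refine mul_ne_zero hξk (mul_ne_zero hpos.ne' (hne (radialProj p))) ?_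
  linear_combination h0 - g.metric (F p) (ξ (F p)) (k' (radialProj p)) * e1
    - g.metric (F p) (ξ (F p)) (k (radialProj p)) * e2

end MarginallyTrapped

end DHS

end

/-! ### Exclusion of horizon leaves and of whole horizons -/

theorem proposition1 {M : Type*} [TopologicalSpace M] [T2Space M] [SecondCountableTopology M]
    [ChartedSpace DHS.E4 M] [IsManifold (𝓡 4) ∞ M] (g : DHS.Spacetime M)
    (R : Set M) (hR : IsOpen R)
    (hξ : ∃ ξ : Π x : M, TangentSpace (𝓡 4) x,
      g.IsKillingOn ξ R ∧ ∀ x ∈ R, g.metric x (ξ x) (ξ x) < 0)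
    {H : Type*} [TopologicalSpace H] [ChartedSpace (EuclideanHalfSpace 3) H]
    [IsManifold (𝓡∂ 3) ∞ H] (j : H → M) :
    (∀ leaves : Set (Set H), g.IsDHSWith j leaves → ∀ S ∈ leaves, ¬ j '' S ⊆ R) ∧
      (g.IsDHS j → ¬ Set.range j ⊆ R) := by
  obtain ⟨ξ, hξK, ht⟩ := hξ
  have hleaf : ∀ leaves : Set (Set H), g.IsDHSWith j leaves → ∀ S ∈ leaves, ¬ j '' S ⊆ R := by
    intro leaves hD S hS hSR
    obtain ⟨σ, k, k', hrange, hMTS, hexp, -⟩ := hD.leaf S hS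
    obtain ⟨y, hy⟩ := hMTS.exists_expansion_eq_zero hR hξK ht (hrange ▸ hSR)
    exact hexp y hy
  refine ⟨hleaf, ?_⟩
  rintro ⟨leaves, hD⟩ hjR
  -- A connected space is nonempty here, so the partition has a leaf, and the first assertion
  -- applies to it.
  obtain ⟨p⟩ := hD.connected.toNonempty
  obtain ⟨S, ⟨hS, -⟩, -⟩ := hD.foliation.1.2 p
  exact hleaf leaves hD S hS ((Set.image_subset_range j S).trans hjR)
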